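/- A tournament is an orientation of a complete graph. A spanning shortcut tree of a tournament $G$ is a binary tree (a rooted tree in which every vertex has at most one left child and at most one right child) whose vertex set is $V(G)$, such that for every vertex $v$ all vertices in the left subtree of $v$ are in-neighbours of $v$ in $G$ and all vertices in the right subtree of $v$ are out-neighbours of $v$ in $G$. The in-order traversal of the tree is a Hamiltonian path $v_1v_2\cdots v_n$ of $G$, and the shortcuts of the tree are the edges $v_iv_j$ of $G$ with $j>i+1$. Let $t(n)$ be the largest integer such that every tournament with $n$ vertices has a spanning shortcut tree with at least $t(n)$ shortcuts. Theorem 3. For every $n\ge 1$ the number $t(n)$ is well defined and $$t(n)\ \ge\ \frac12\binom n2+\frac{n\ln n}{5}-3122 .$$ Furthermore, there is an algorithm (a program for a unit-cost word RAM with words of $O(\log n)$ bits, whose input is the adjacency matrix) that, given a tournament with $n\ge 1$ vertices, finds in $O(n^2)$ time a spanning shortcut tree with at least $\frac12\binom n2+\frac{n\ln n}{5}-3122$ shortcuts. On the other hand, for all sufficiently large $n$, $$t(n)\ \le\ \frac12\binom n2+4n(\log_2 n)^2 ,$$ and there is a tournament with $n$ vertices none of whose spanning shortcut trees has more than $\frac12\binom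 n2+4n(\log_2 n)^2$ shortcuts. -/

import Mathlib

/-! ### Tournaments, shortcut trees and shortcuts -/

/-- A tournament: an orientation of the complete graph on `V`. -/
def Digraph.IsTournament {V : Type*} (G : Digraph V) : Prop :=
  (∀ v, ¬ G.Adj v v) ∧ ∀ u v, u ≠ v → Xor (G.Adj u v) (G.Adj v u)

/-- The vertices of a binary tree, listed in the in-order. -/
def BinaryTree.inorder {V : Type*} : BinaryTree V → List V
  | .nil => []
  | .node v l r => l.inorder ++ v :: r.inorder

/-- For every vertex of the tree, all its left descendants are in-neighbors and all its right
descendants are out-neighbors. -/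
def Digraph.IsShortcutTree {V : Type*} (G : Digraph V) : BinaryTree V → Prop
  | .nil => True
  | .node v l r =>
      (∀ u ∈ l.inorder, G.Adj u v) ∧ (∀ w ∈ r.inorder, G.Adj v w) ∧
        G.IsShortcutTree l ∧ G.IsShortcutTree r

/-- A spanning shortcut tree: every vertex of `G` is the label of exactly one tree node, and the
tree is a shortcut tree. (The two endpoints of a tree edge are adjacent in `G`, in the direction
given by the side of the child.) -/
def Digraph.IsSpanningShortcutTree {V : Type*} (G : Digraph V) (T : BinaryTree V) : Prop :=
  T.inorder.Nodup ∧ (∀ v, v ∈ T.inorder) ∧ G.IsShortcutTree T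

open Classical in
/-- The number of shortcuts of a path `p = v₁ v₂ ⋯`, i.e. of edges `vᵢ vⱼ` with `j > i + 1`. -/
noncomputable def Digraph.numPathShortcuts {V : Type*} (G : Digraph V) (p : List V) : ℕ :=
  (Finset.univ.filter fun ij : Fin p.length × Fin p.length =>
    ij.1.val + 1 < ij.2.val ∧ G.Adj (p.get ij.1) (p.get ij.2)).card

/-- The number of shortcuts of a shortcut tree is that of its in-order Hamiltonian path. -/
noncomputable def Digraph.numShortcuts {V : Type*} (G : Digraph V) (T : BinaryTree V) : ℕ :=
  G.numPathShortcuts T.inorder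

/-- The numbers `k` such that every tournament with `n` vertices has a spanning shortcut tree with
at least `k` shortcuts. -/
def guaranteedShortcuts (n : ℕ) : Set ℕ :=
  {k | ∀ G : Digraph (Fin n), G.IsTournament →
    ∃ T : BinaryTree (Fin n), G.IsSpanningShortcutTree T ∧ k ≤ G.numShortcuts T}

/-- `t(n)`: the largest integer such that every tournament with `n` vertices has a spanning
shortcut tree with at least `t(n)` shortcuts. -/
noncomputable def shortcutNumber (n : ℕ) : ℕ := sSup (guaranteedShortcuts n)

/-! ### The machine model: a unit-cost word RAM -/

namespace WordRAM

/-- Programs of a random access machine, with structured control flow. Registers are named by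
natural numbers; a program mentions only finitely many of them. A load or store uses the contents
of a register as an address in the memory. -/
inductive Program : Type
  /-- do nothing -/
  | skip : Program
  /-- `x := k` -/
  | const (x k : ℕ) : Program
  /-- `x := y` -/
  | move (x y : ℕ) : Program
  /-- `x := y + z` -/
  | add (x y z : ℕ) : Program
  /-- `x := max (y - z) 0` -/
  | sub (x y z : ℕ) : Program
  /-- `x := y * z` -/
  | mul (x y z : ℕ) : Program
  /-- `x := mem[y]` -/
  | load (x y : ℕ) : Program
  /-- `mem[x] := y` -/
  | store (x y : ℕ) : Program
  /-- run `p`, then `q` -/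
  | seq (p q : Program) : Program
  /-- if `x < y` then run `p`, else run `q` -/
  | ifLt (x y : ℕ) (p q : Program) : Program
  /-- while `x < y` run `p` -/
  | whileLt (x y : ℕ) (p : Program) : Program

/-- The state of the machine: the contents of the registers and of the memory cells. -/
structure State where
  reg : ℕ → ℕ
  mem : ℕ → ℕ

/-- The state `s` after the register `x` has been set to `v`. -/
def State.setReg (s : State) (x v : ℕ) : State := ⟨Function.update s.reg x v, s.mem⟩

/-- The state `s` after the memory cell `a` has been set to `v`. -/
def State.setMem (s : State) (a v : ℕ) : State := ⟨s.reg, Function.update s.mem a v⟩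

/-- `Exec W p s t s'`: on a machine whose words hold the numbers below `W`, the program `p`, started
in the state `s`, halts in the state `s'` after exactly `t` steps. Each instruction and each
evaluation of a branching condition is one step. An instruction whose result does not fit into a
word has no transition, so a program that overflows does not halt. -/
inductive Exec (W : ℕ) : Program → State → ℕ → State → Prop
  | skip (s : State) : Exec W .skip s 1 s
  | const (s : State) (x k : ℕ) (h : k < W) : Exec W (.const x k) s 1 (s.setReg x k)
  | move (s : State) (x y : ℕ) (h : s.reg y < W) :
      Exec W (.move x y) s 1 (s.setReg x (s.reg y))
  | add (s : State) (x y z : ℕ) (h : s.reg y + s.reg z < W) :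
      Exec W (.add x y z) s 1 (s.setReg x (s.reg y + s.reg z))
  | sub (s : State) (x y z : ℕ) (h : s.reg y - s.reg z < W) :
      Exec W (.sub x y z) s 1 (s.setReg x (s.reg y - s.reg z))
  | mul (s : State) (x y z : ℕ) (h : s.reg y * s.reg z < W) :
      Exec W (.mul x y z) s 1 (s.setReg x (s.reg y * s.reg z))
  | load (s : State) (x y : ℕ) (ha : s.reg y < W) (h : s.mem (s.reg y) < W) :
      Exec W (.load x y) s 1 (s.setReg x (s.mem (s.reg y)))
  | store (s : State) (x y : ℕ) (ha : s.reg x < W) (h : s.reg y < W) :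
      Exec W (.store x y) s 1 (s.setMem (s.reg x) (s.reg y))
  | seq {p q : Program} {s s₁ s₂ : State} {t₁ t₂ : ℕ}
      (hp : Exec W p s t₁ s₁) (hq : Exec W q s₁ t₂ s₂) : Exec W (.seq p q) s (t₁ + t₂) s₂
  | ifLt_true {x y : ℕ} {p q : Program} {s s' : State} {t : ℕ}
      (h : s.reg x < s.reg y) (hp : Exec W p s t s') : Exec W (.ifLt x y p q) s (1 + t) s'
  | ifLt_false {x y : ℕ} {p q : Program} {s s' : State} {t : ℕ}
      (h : ¬ s.reg x < s.reg y) (hq : Exec W q s t s') : Exec W (.ifLt x y p q) s (1 + t) s'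
  | whileLt_true {x y : ℕ} {p : Program} {s s₁ s₂ : State} {t₁ t₂ : ℕ}
      (h : s.reg x < s.reg y) (hp : Exec W p s t₁ s₁)
      (hw : Exec W (.whileLt x y p) s₁ t₂ s₂) : Exec W (.whileLt x y p) s (1 + t₁ + t₂) s₂
  | whileLt_false {x y : ℕ} {p : Program} {s : State}
      (h : ¬ s.reg x < s.reg y) : Exec W (.whileLt x y p) s 1 s

open Classical in
/-- The initial state for a digraph `G` with vertices `0, …, n - 1`: register `0` holds `n`, the
memory cells `0, …, n² - 1` hold the adjacency matrix of `G` row by row, and every other register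
and memory cell is `0`. -/
noncomputable def inputState {n : ℕ} (G : Digraph (Fin n)) : State where
  reg x := if x = 0 then n else 0
  mem a := if ∃ i j : Fin n, a = i.val * n + j.val ∧ G.Adj i j then 1 else 0

/-- The pointer `p` represents the binary tree `T` in the memory `mem`, with a table of children
that begins at the address `b`: the empty tree is the pointer `0`, and a tree with root `v` is the
pointer `v + 1`, the pointers to its left and right subtrees being stored at `b + 2v` and
`b + 2v + 1`. -/
def Represents {n : ℕ} (mem : ℕ → ℕ) (b : ℕ) : BinaryTree (Fin n) → ℕ → Prop
  | .nil, p => p = 0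
  | .node v l r, p =>
      p = v.val + 1 ∧ Represents mem b l (mem (b + 2 * v.val)) ∧
        Represents mem b r (mem (b + 2 * v.val + 1))

/-- In the final state `s` the machine outputs the binary tree `T`: register `0` is a pointer to
`T`, with the table of children placed directly behind the `n²` input cells. -/
def Outputs {n : ℕ} (s : State) (T : BinaryTree (Fin n)) : Prop :=
  Represents s.mem (n * n) T (s.reg 0)

end WordRAM

/-! ### Forward edges of a vertex ordering -/

section Forward

variable {V : Type*}

/-! The in-order path has n - 1 edges that are not shortcuts, so it suffices to count its forward
edges. If a root has l vertices on its left and r on its right, all l + r edges at the root are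
forward. What remains are the edges inside the two sides, handled by recursion, and the edges
between them.

Lower bound. Choose as root of every subtree a vertex of smallest `pivotScore`. The average score
depends only on the number m of vertices, so a minimal vertex satisfies 4 e(R,L) + (m-1)(m-2) ≤ 6lr
(`pivot_bound`), where e(R,L) counts the backward edges between the sides. Hence at least (l² + r² -
l - r)/4 edges between the sides are forward. Together with the l + r edges at the root this exceeds
one half by an amount linear in m, and the surplus recurs at each of the at least logarithmically
many levels. The potential (m+1) log₂(m+1) accounts for it by convexity of x log x
(`fwdCount_greedy_ge`).

Running time. The same inequality forces 3(l² + r²) ≤ 2m² (`pivot_balanced`). Finding a pivot costs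
O(m²), so the costs of successive levels decrease geometrically and add up to O(n²).
`mainLoop_solve` carries this out for a program that keeps a linked stack of pending vertex lists.

Upper bound. Orient every pair by a fair coin. The vertex set of a subtree is determined by the path
from the root to it (`pathSet`), so a union bound over paths replaces one over trees. With ℓ = ⌈log₂
n⌉, positive probability remains that all sets at depth 2ℓ have at most 2ℓ + 3 elements and that,
higher up, the edges between the two sides of any pivot deviate from balance by at most 2ℓ(l + r)
(`exists_good_coins`). Each of the 2ℓ levels then gains only O(ℓ) per vertex, which gives O(n log²
n) in total (`fwdCount_shortcutTree_le`). -/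

/-- The number of pairs in `l ×ˢ r` that are related by `A`. -/
def crossCount (A : V → V → Bool) (l r : List V) : ℕ := (l.map fun x => r.countP (A x)).sum

/-- The number of forward edges of the list `p`. -/
def fwdCount (A : V → V → Bool) : List V → ℕ
  | [] => 0
  | x :: p => p.countP (A x) + fwdCount A p

theorem fwdCount_append (A : V → V → Bool) (l r : List V) :
    fwdCount A (l ++ r) = fwdCount A l + fwdCount A r + crossCount A l r := by
  induction l with
  | nil => simp [fwdCount, crossCount]
  | cons x l ih =>
    simp only [List.cons_append, fwdCount, List.countP_append, ih, crossCount, List.map_cons,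
      List.sum_cons]
    omega

theorem crossCount_cons_right (A : V → V → Bool) (l r : List V) (v : V) :
    crossCount A l (v :: r) = crossCount A l r + l.countP fun x => A x v := by
  induction l with
  | nil => simp [crossCount]
  | cons x l ih =>
    simp only [crossCount, List.map_cons, List.sum_cons, List.countP_cons] at ih ⊢
    omega

theorem fwdCount_node (A : V → V → Bool) (l r : List V) (v : V)
    (hl : ∀ x ∈ l, A x v = true) (hr : ∀ x ∈ r, A v x = true) :
    fwdCount A (l ++ v :: r) =
      fwdCount A l + fwdCount A r + crossCount A l r + l.length + r.length := by
  rw [fwdCount_append, crossCount_cons_right, fwdCount, List.countP_eq_length.2 hl,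
    List.countP_eq_length.2 hr]
  omega

theorem crossCount_perm (A : V → V → Bool) {l l' r r' : List V} (hl : l.Perm l')
    (hr : r.Perm r') : crossCount A l r = crossCount A l' r' := by
  have h : (fun x => r.countP (A x)) = fun x => r'.countP (A x) := by
    funext x
    exact hr.countP_eq _
  rw [crossCount, crossCount, h]
  exact (hl.map _).sum_eq

theorem crossCount_nil_right (A : V → V → Bool) (l : List V) : crossCount A l [] = 0 := by
  simp [crossCount]

theorem crossCount_cons_left (A : V → V → Bool) (l r : List V) (v : V) :
    crossCount A (v :: l) r = r.countP (A v) + crossCount A l r := by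
  simp [crossCount]

/-- Between two disjoint parts every edge goes one way or the other. -/
theorem crossCount_add_crossCount (A : V → V → Bool) (l r : List V)
    (h : ∀ x ∈ l, ∀ y ∈ r, A x y = !A y x) :
    crossCount A l r + crossCount A r l = l.length * r.length := by
  induction l with
  | nil => simp [crossCount]
  | cons x l ih =>
    have ih' := ih fun x hx => h x (List.mem_cons_of_mem _ hx)
    rw [crossCount_cons_left, crossCount_cons_right]
    have h1 : r.countP (A x) + (r.countP fun y => A y x) = r.length := by
      have : r.countP (fun y => A y x) = r.countP (fun y => ¬ A x y) := by
        apply List.countP_congr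
        intro y hy
        simp [h x List.mem_cons_self y hy]
      rw [this, List.length_eq_countP_add_countP (A x)]
    simp only [List.length_cons, add_mul, one_mul]
    omega

theorem crossCount_append_right (A : V → V → Bool) (l r r' : List V) :
    crossCount A l (r ++ r') = crossCount A l r + crossCount A l r' := by
  induction l with
  | nil => simp [crossCount]
  | cons x l ih => simp only [crossCount_cons_left, ih, List.countP_append]; omega

/-- The number of edges inside a set of vertices of a tournament. -/
theorem two_mul_crossCount_self (A : V → V → Bool) (hA : ∀ x, A x x = false)
    (hA' : ∀ x y, x ≠ y → A x y = !A y x) (l : List V) (hl : l.Nodup) :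
    2 * crossCount A l l + l.length = l.length * l.length := by
  induction l with
  | nil => simp [crossCount]
  | cons x l ih =>
    rw [List.nodup_cons] at hl
    have h1 := ih hl.2
    have h2 := crossCount_add_crossCount A [x] l (by
      intro y hy z hz
      rw [List.mem_singleton] at hy
      subst hy
      exact hA' _ _ fun h => hl.1 (h ▸ hz))
    rw [crossCount_cons_left, crossCount_cons_right]
    simp only [crossCount_cons_left, crossCount_cons_right, List.countP_cons, hA, List.length_cons]
      at h2 ⊢
    simp [crossCount] at h1 h2 ⊢
    nlinarith

open Classical in
theorem numPathShortcuts_cons_cons (G : Digraph V) (x y : V) (p : List V) :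
    G.numPathShortcuts (x :: y :: p) =
      p.countP (fun z => decide (G.Adj x z)) + G.numPathShortcuts (y :: p) := by
  have key : ∀ q : List V, G.numPathShortcuts q = ∑ i : Fin q.length, ∑ j : Fin q.length,
      if i.val + 1 < j.val ∧ G.Adj (q.get i) (q.get j) then 1 else 0 := by
    intro q
    rw [Digraph.numPathShortcuts, Finset.card_filter, ← Finset.univ_product_univ,
      Finset.sum_product]
  have cnt : ∀ q : List V, q.countP (fun z => decide (G.Adj x z)) =
      ∑ j : Fin q.length, if G.Adj x (q.get j) then 1 else 0 := by
    intro q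
    induction q with
    | nil => simp
    | cons z q ih =>
      rw [List.countP_cons, ih]
      simp only [List.length_cons, Fin.sum_univ_succ]
      simp only [List.get_eq_getElem, Fin.val_zero, Fin.val_succ, List.getElem_cons_zero,
        List.getElem_cons_succ, decide_eq_true_eq]
      rw [add_comm]
      congr
  -- The first vertex has shortcuts exactly to its out-neighbours beyond `y`. Splitting off the
  -- index 0 in both sums isolates them.
  rw [key, key, cnt]
  simp only [List.length_cons, Fin.sum_univ_succ (n := p.length + 1)]
  simp only [List.get_eq_getElem, Fin.val_zero, Fin.val_succ, List.getElem_cons_zero,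
    List.getElem_cons_succ, Nat.not_lt_zero, false_and, if_false, zero_add, add_lt_add_iff_right]
  congr 1
  rw [Fin.sum_univ_succ]
  simp

open Classical in
/-- The edges of a path that are not shortcuts join consecutive vertices. -/
theorem numPathShortcuts_add (G : Digraph V) (p : List V) (h : p.IsChain G.Adj) :
    G.numPathShortcuts p + (p.length - 1) = fwdCount (fun x y => decide (G.Adj x y)) p := by
  induction p with
  | nil => simp [Digraph.numPathShortcuts, fwdCount]
  | cons x p ih =>
    cases p with
    | nil => simp [Digraph.numPathShortcuts, fwdCount]
    | cons y p =>
      rw [List.isChain_cons_cons] at h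
      have := ih h.2
      rw [numPathShortcuts_cons_cons]
      simp only [fwdCount, List.countP_cons, h.1, List.length_cons] at this ⊢
      simp
      simp at this
      omega

theorem isChain_inorder {G : Digraph V} {T : BinaryTree V} (h : G.IsShortcutTree T) :
    T.inorder.IsChain G.Adj := by
  induction T with
  | nil => simp [BinaryTree.inorder]
  | node v l r ihl ihr =>
    obtain ⟨hl, hr, h1, h2⟩ := h
    rw [BinaryTree.inorder, List.isChain_append]
    refine ⟨ihl h1, ?_, ?_⟩
    · rw [List.isChain_cons]
      exact ⟨fun y hy => hr y (List.mem_of_mem_head? hy), ihr h2⟩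
    · intro x hx y hy
      simp at hy
      subst hy
      exact hl x (List.mem_of_mem_getLast? hx)

theorem length_inorder_of_spanning {n : ℕ} {G : Digraph (Fin n)} {T : BinaryTree (Fin n)}
    (h : G.IsSpanningShortcutTree T) : T.inorder.length = n := by
  have h1 : T.inorder.toFinset = Finset.univ := by
    ext v
    simp [h.2.1 v]
  rw [← List.toFinset_card_of_nodup h.1, h1]
  simp

open Classical in
theorem numShortcuts_add {n : ℕ} {G : Digraph (Fin n)} {T : BinaryTree (Fin n)}
    (h : G.IsSpanningShortcutTree T) :
    G.numShortcuts T + (n - 1) = fwdCount (fun x y => decide (G.Adj x y)) T.inorder := by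
  rw [← numPathShortcuts_add G _ (isChain_inorder h.2.2), length_inorder_of_spanning h]
  rfl

end Forward

/-! ### Pivots with many forward edges -/

section Pivot

variable {V : Type*}

/-- The score of `v` in the tournament induced on `xs`; small scores make good pivots. -/
def pivotScore (A : V → V → Bool) (xs : List V) (v : V) : ℕ :=
  (xs.map fun u => if A v u then 2 * (xs.countP (A v) + xs.countP (A u) + 2)
    else 3 * xs.length).sum

/-- The trees that arise if the root of each subtree has the smallest score. -/
def IsGreedyTree (A : V → V → Bool) : BinaryTree V → List V → Prop
  | .nil, xs => xs = []
  | .node v l r, xs => v ∈ xs ∧ (∀ u ∈ xs, pivotScore A xs v ≤ pivotScore A xs u) ∧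
      IsGreedyTree A l (xs.filter fun u => A u v) ∧ IsGreedyTree A r (xs.filter (A v))

/-- `A` is the Boolean adjacency relation of a tournament. -/
def IsTournamentRel (A : V → V → Bool) : Prop :=
  (∀ x, A x x = false) ∧ ∀ x y, x ≠ y → A x y = !A y x

/-- The weights of the score are chosen for a cancellation: the own degree contributes 4 ∑ d², and
the degrees of the out-neighbours contribute 4 ∑ ((m-1)d - d²). Only ∑ d = m(m-1)/2 survives, so the
total does not depend on the tournament. -/
theorem sum_score_eq (S : Finset V) (a : V → V → ℤ) (d : V → ℤ) (m : ℤ) (hm : (S.card : ℤ) = m)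
    (hd : ∀ v ∈ S, d v = ∑ u ∈ S, a v u) (hd' : ∀ u ∈ S, ∑ v ∈ S, a v u = m - 1 - d u) :
    ∑ v ∈ S, 2 * ∑ u ∈ S, (a v u * (2 * (d v + d u + 2)) + (1 - a v u) * (3 * m)) =
      m * (6 * m ^ 2 - (m - 1) * (m - 2)) := by
  have hsum : 2 * ∑ v ∈ S, d v = m * (m - 1) := by
    have h1 : ∑ v ∈ S, d v = ∑ u ∈ S, (m - 1 - d u) := by
      rw [Finset.sum_congr rfl hd, Finset.sum_comm]
      exact Finset.sum_congr rfl hd'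
    rw [Finset.sum_sub_distrib, Finset.sum_const, nsmul_eq_mul, hm] at h1
    linarith
  have h2 : ∀ v ∈ S, 2 * ∑ u ∈ S, (a v u * (2 * (d v + d u + 2)) + (1 - a v u) * (3 * m)) =
      4 * d v * d v + 8 * d v + 6 * m * m - 6 * m * d v + 4 * ∑ u ∈ S, a v u * d u := by
    intro v hv
    have : ∀ u ∈ S, a v u * (2 * (d v + d u + 2)) + (1 - a v u) * (3 * m) =
        (2 * d v + 4 - 3 * m) * a v u + 2 * (a v u * d u) + 3 * m := by
      intro u _
      ring
    rw [Finset.sum_congr rfl this, Finset.sum_add_distrib, Finset.sum_add_distrib,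
      ← Finset.mul_sum, ← Finset.mul_sum, ← hd v hv, Finset.sum_const, nsmul_eq_mul, hm]
    ring
  have h3 : ∑ v ∈ S, ∑ u ∈ S, a v u * d u = ∑ u ∈ S, ((m - 1) * d u - d u * d u) := by
    rw [Finset.sum_comm]
    refine Finset.sum_congr rfl fun u hu => ?_
    rw [← Finset.sum_mul, hd' u hu]
    ring
  rw [Finset.sum_congr rfl h2, Finset.sum_add_distrib, ← Finset.mul_sum, h3]
  have h4 : ∀ v ∈ S, 4 * d v * d v + 8 * d v + 6 * m * m - 6 * m * d v =
      4 * (d v * d v) + (8 - 6 * m) * d v + 6 * m * m := by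
    intro v _
    ring
  rw [Finset.sum_congr rfl h4, Finset.sum_add_distrib, Finset.sum_add_distrib,
    Finset.sum_sub_distrib, ← Finset.mul_sum, ← Finset.mul_sum, ← Finset.mul_sum,
    ← Finset.mul_sum, Finset.sum_const, nsmul_eq_mul, hm]
  linear_combination (2 - m) * hsum

theorem countP_eq_sum_toFinset [DecidableEq V] (p : V → Bool) {xs : List V} (h : xs.Nodup) :
    (xs.countP p : ℤ) = ∑ u ∈ xs.toFinset, if p u then 1 else 0 := by
  rw [List.sum_toFinset _ h]
  clear h
  induction xs with
  | nil => simp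
  | cons x xs ih =>
    simp only [List.countP_cons, List.map_cons, List.sum_cons, ← ih]
    push_cast
    ring

theorem countP_out_add_countP_in {A : V → V → Bool} (hA : IsTournamentRel A) {xs : List V}
    (h : xs.Nodup) {v : V} (hv : v ∈ xs) :
    xs.countP (A v) + xs.countP (fun u => A u v) + 1 = xs.length := by
  classical
  have hp := List.perm_cons_erase hv
  rw [hp.countP_eq, hp.countP_eq, hp.length_eq]
  have hc := crossCount_add_crossCount A [v] (xs.erase v) (by
    intro y hy z hz
    rw [List.mem_singleton] at hy
    subst hy
    exact hA.2 _ _ fun e => (h.mem_erase_iff.1 hz).1 e.symm)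
  rw [crossCount_cons_left] at hc
  have : crossCount A (xs.erase v) [v] = (xs.erase v).countP fun u => A u v := by
    rw [crossCount_cons_right, crossCount_nil_right, zero_add]
  rw [this] at hc
  simp only [List.countP_cons, hA.1, List.length_cons, List.length_nil] at hc ⊢
  simp [crossCount] at hc ⊢
  omega

/-- Averaging: were every score above the bound, their sum would exceed the value in `sum_score_eq`.
-/
theorem exists_pivotScore_le {A : V → V → Bool} (hA : IsTournamentRel A) {xs : List V}
    (h : xs.Nodup) (hne : xs ≠ []) : ∃ v ∈ xs, 2 * (pivotScore A xs v : ℤ) ≤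
      6 * (xs.length : ℤ) ^ 2 - ((xs.length : ℤ) - 1) * (xs.length - 2) := by
  classical
  have hcard : xs.toFinset.card = xs.length := List.toFinset_card_of_nodup h
  set a : V → V → ℤ := fun v u => if A v u then 1 else 0 with ha
  have hd : ∀ v, (xs.countP (A v) : ℤ) = ∑ u ∈ xs.toFinset, a v u := fun v =>
    countP_eq_sum_toFinset _ h
  have hd' : ∀ u, (xs.countP (fun v => A v u) : ℤ) = ∑ v ∈ xs.toFinset, a v u := fun v =>
    countP_eq_sum_toFinset _ h
  have hsum := sum_score_eq xs.toFinset a (fun v => xs.countP (A v)) xs.length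
    (by rw [hcard]) (fun v _ => hd v) (by
      intro u hu
      have := countP_out_add_countP_in hA h (List.mem_toFinset.1 hu)
      rw [← hd']
      omega)
  have hs : ∀ v ∈ xs.toFinset, 2 * (pivotScore A xs v : ℤ) = 2 * ∑ u ∈ xs.toFinset,
      (a v u * (2 * ((xs.countP (A v) : ℤ) + xs.countP (A u) + 2)) +
        (1 - a v u) * (3 * xs.length)) := by
    intro v _
    rw [List.sum_toFinset _ h, pivotScore]
    congr 1
    rw [Nat.cast_list_sum, List.map_map]
    congr 2
    funext u
    simp only [ha, Function.comp]
    split_ifs <;> push_cast <;> ring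
  rw [← Finset.sum_congr rfl hs] at hsum
  by_contra! hcon
  have hlt := Finset.sum_lt_sum_of_nonempty (s := xs.toFinset)
    (by simpa [Finset.nonempty_iff_ne_empty] using hne)
    (fun v hv => hcon v (List.mem_toFinset.1 hv))
  rw [hsum, Finset.sum_const, hcard, nsmul_eq_mul] at hlt
  exact lt_irrefl _ hlt

theorem sum_map_ite_eq (p : V → Bool) (f : V → ℕ) (c : ℕ) (xs : List V) :
    (xs.map fun u => if p u then f u else c).sum =
      ((xs.filter p).map f).sum + c * (xs.length - (xs.filter p).length) := by
  induction xs with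
  | nil => simp
  | cons x xs ih =>
    have := List.length_filter_le p xs
    simp only [List.map_cons, List.sum_cons, List.filter_cons, List.length_cons, ih]
    by_cases hx : p x
    · simp [hx]
      ring
    · simp [hx]
      rw [Nat.sub_add_comm this]
      ring

/-- The list of a tournament is rearranged around a pivot. -/
theorem perm_pivot {A : V → V → Bool} (hA : IsTournamentRel A) {xs : List V}
    (h : xs.Nodup) {v : V} (hv : v ∈ xs) :
    xs.Perm ((xs.filter fun u => A u v) ++ v :: xs.filter (A v)) := by
  classical
  rw [List.perm_ext_iff_of_nodup h]
  · intro u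
    simp only [List.mem_append, List.mem_filter, List.mem_cons]
    by_cases huv : u = v
    · simp [huv, hv]
    · have := hA.2 u v huv
      cases h' : A v u <;> simp_all
  · rw [List.nodup_append]
    refine ⟨h.filter _, ?_, ?_⟩
    · rw [List.nodup_cons]
      exact ⟨by simp [hA.1], h.filter _⟩
    · intro x hx y hy hxy
      subst hxy
      rw [List.mem_filter] at hx
      rw [List.mem_cons, List.mem_filter] at hy
      rcases hy with rfl | hy
      · simp [hA.1] at hx
      · by_cases hxv : x = v
        · subst hxv
          simp [hA.1] at hx
        · have := hA.2 x v hxv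
          simp_all

/-- A vertex of the smallest score has many forward edges across, and balanced neighborhoods. -/
theorem pivot_bound {A : V → V → Bool} (hA : IsTournamentRel A) {xs : List V}
    (h : xs.Nodup) {v : V} (hv : v ∈ xs)
    (hmin : ∀ u ∈ xs, pivotScore A xs v ≤ pivotScore A xs u) :
    4 * (crossCount A (xs.filter (A v)) (xs.filter fun u => A u v) : ℤ) +
      ((xs.length : ℤ) - 1) * (xs.length - 2) ≤
        6 * (xs.filter fun u => A u v).length * (xs.filter (A v)).length := by
  obtain ⟨w, hw, hw'⟩ := exists_pivotScore_le hA h (List.ne_nil_of_mem hv)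
  have h1 : 2 * (pivotScore A xs v : ℤ) ≤
      6 * (xs.length : ℤ) ^ 2 - ((xs.length : ℤ) - 1) * (xs.length - 2) := by
    have := hmin w hw
    omega
  have hp := perm_pivot hA h hv
  have hlen := hp.length_eq
  rw [pivotScore, sum_map_ite_eq, List.countP_eq_length_filter] at h1
  set L := xs.filter fun u => A u v with hL
  set R := xs.filter (A v) with hR
  have h2 : (R.map fun u => 2 * (R.length + xs.countP (A u) + 2)).sum =
      2 * crossCount A R xs + R.length * (2 * R.length + 4) := by
    have hg : ∀ (b : ℕ) (R : List V), (R.map fun u => 2 * (b + xs.countP (A u) + 2)).sum =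
        2 * crossCount A R xs + R.length * (2 * b + 4) := by
      intro b R
      induction R with
      | nil => simp [crossCount]
      | cons x R ih =>
        simp only [List.map_cons, List.sum_cons, List.length_cons, ih, crossCount_cons_left]
        ring
    exact hg _ _
  -- An edge that leaves a vertex of R ends in L or in R, never at `v`. The edges inside R number
  -- r(r-1)/2, so the score determines e(R,L).
  have h3 : crossCount A R xs = crossCount A R L + crossCount A R R := by
    rw [crossCount_perm A (List.Perm.refl R) hp, crossCount_append_right, crossCount_cons_right]
    have : R.countP (fun x => A x v) = 0 := by
      rw [List.countP_eq_zero]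
      intro x hx
      rw [hR, List.mem_filter] at hx
      have hxv : x ≠ v := by
        rintro rfl
        simp [hA.1] at hx
      simp [hA.2 x v hxv, hx.2]
    omega
  have h4 := two_mul_crossCount_self A hA.1 hA.2 R (h.filter _)
  rw [h2, h3] at h1
  simp only [List.length_append, List.length_cons] at hlen
  have h5 : xs.length - R.length = L.length + 1 := by omega
  rw [h5] at h1
  push_cast at h1
  rw [hlen] at h1 ⊢
  zify at h4
  push_cast at h1 ⊢
  -- After substituting m = l + r + 1, the terms 6m² - 6m(l+1) - 6r² - 6r collapse to 6lr.
  nlinarith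

/-- Dropping the nonnegative edge count from `pivot_bound` leaves (m-1)(m-2) ≤ 6lr, and 2lr = (m-1)²
- l² - r². The factor 2/3 is what makes the total running time and memory quadratic. -/
theorem pivot_balanced {A : V → V → Bool} (hA : IsTournamentRel A) {xs : List V}
    (h : xs.Nodup) {v : V} (hv : v ∈ xs)
    (hmin : ∀ u ∈ xs, pivotScore A xs v ≤ pivotScore A xs u) :
    (xs.filter fun u => A u v).length + (xs.filter (A v)).length + 1 = xs.length ∧
    3 * ((xs.filter fun u => A u v).length ^ 2 + (xs.filter (A v)).length ^ 2) ≤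
      2 * xs.length ^ 2 := by
  have h1 := pivot_bound hA h hv hmin
  have h2 := (perm_pivot hA h hv).length_eq
  simp only [List.length_append, List.length_cons] at h2
  refine ⟨by omega, ?_⟩
  rw [h2] at h1 ⊢
  zify
  push_cast at h1
  nlinarith

theorem inorder_perm_of_greedy {A : V → V → Bool} (hA : IsTournamentRel A) {T : BinaryTree V}
    {xs : List V} (h : xs.Nodup) (hT : IsGreedyTree A T xs) : T.inorder.Perm xs := by
  induction T generalizing xs with
  | nil => rw [show xs = [] from hT]; exact List.Perm.refl _
  | node v l r ihl ihr =>
    obtain ⟨hv, -, hl, hr⟩ := hT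
    exact ((ihl (h.filter _) hl).append ((ihr (h.filter _) hr).cons v)).trans
      (perm_pivot hA h hv).symm

theorem isShortcutTree_of_greedy {G : Digraph V} {A : V → V → Bool}
    (hG : ∀ x y, A x y = true ↔ G.Adj x y) (hA : IsTournamentRel A) {T : BinaryTree V}
    {xs : List V} (h : xs.Nodup) (hT : IsGreedyTree A T xs) : G.IsShortcutTree T := by
  induction T generalizing xs with
  | nil => trivial
  | node v l r ihl ihr =>
    obtain ⟨-, -, hl, hr⟩ := hT
    refine ⟨fun u hu => ?_, fun w hw => ?_, ihl (h.filter _) hl, ihr (h.filter _) hr⟩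
    · have := (inorder_perm_of_greedy hA (h.filter _) hl).mem_iff.1 hu
      exact (hG _ _).1 (List.mem_filter.1 this).2
    · have := (inorder_perm_of_greedy hA (h.filter _) hr).mem_iff.1 hw
      exact (hG _ _).1 (List.mem_filter.1 this).2

/-! ### The logarithmic gain of the greedy tree -/

/-- Midpoint convexity of x log x; halving the argument costs exactly one binary logarithm. -/
theorem mul_logb_add_mul_logb_ge {x y : ℝ} (hx : 0 < x) (hy : 0 < y) :
    (x + y) * Real.logb 2 (x + y) - (x + y) ≤ x * Real.logb 2 x + y * Real.logb 2 y := by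
  have h := Real.convexOn_mul_log.2 (Set.mem_Ici.2 hx.le) (Set.mem_Ici.2 hy.le)
    (show (0 : ℝ) ≤ 1 / 2 by norm_num) (show (0 : ℝ) ≤ 1 / 2 by norm_num) (by norm_num)
  simp only [smul_eq_mul] at h
  have h2 : Real.log (1 / 2 * x + 1 / 2 * y) = Real.log (x + y) - Real.log 2 := by
    rw [← Real.log_div (by positivity) (by norm_num)]
    congr 1
    ring
  rw [h2] at h
  have hl : 0 < Real.log 2 := Real.log_pos (by norm_num)
  simp only [Real.logb]
  rw [← sub_nonneg]
  have : x * (Real.log x / Real.log 2) + y * (Real.log y / Real.log 2) -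
      ((x + y) * (Real.log (x + y) / Real.log 2) - (x + y)) =
      (x * Real.log x + y * Real.log y - (x + y) * (Real.log (x + y) - Real.log 2)) /
        Real.log 2 := by
    field_simp
  rw [this]
  apply div_nonneg _ hl.le
  linarith

/-- The potential has m + 1 in place of m because (l+1) + (r+1) = m + 1, so convexity applies
without remainder. The linear term -2m makes the induction step exact when l = r and the bound on
crossing edges is attained. -/
theorem fwdCount_greedy_ge {A : V → V → Bool} (hA : IsTournamentRel A) {T : BinaryTree V}
    {xs : List V} (h : xs.Nodup) (hT : IsGreedyTree A T xs) :
    (xs.length : ℝ) * (xs.length - 1) +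
      ((xs.length : ℝ) + 1) * Real.logb 2 (xs.length + 1) - 2 * xs.length ≤
        4 * (fwdCount A T.inorder : ℝ) := by
  induction T generalizing xs with
  | nil =>
    rw [show xs = [] from hT]
    simp
  | node v l r ihl ihr =>
    obtain ⟨hv, hmin, hl, hr⟩ := hT
    have hpl := inorder_perm_of_greedy hA (h.filter _) hl
    have hpr := inorder_perm_of_greedy hA (h.filter _) hr
    have h1 := ihl (h.filter _) hl
    have h2 := ihr (h.filter _) hr
    have h3 := pivot_bound hA h hv hmin
    have h4 := (perm_pivot hA h hv).length_eq
    rw [BinaryTree.inorder, fwdCount_node A _ _ v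
      (fun x hx => (List.mem_filter.1 (hpl.mem_iff.1 hx)).2)
      (fun x hx => (List.mem_filter.1 (hpr.mem_iff.1 hx)).2), crossCount_perm A hpl hpr,
      hpl.length_eq, hpr.length_eq]
    have h5 := crossCount_add_crossCount A (xs.filter fun u => A u v) (xs.filter (A v)) (by
      intro x hx y hy
      apply hA.2
      rintro rfl
      have e1 := (List.mem_filter.1 hx).2
      have e2 := (List.mem_filter.1 hy).2
      have hxv : x ≠ v := by
        rintro rfl
        simp [hA.1] at e1
      simp [hA.2 _ _ hxv, e2] at e1)
    simp only [List.length_append, List.length_cons] at h4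
    rw [h4] at h3 ⊢
    set a := (xs.filter fun u => A u v).length
    set b := (xs.filter (A v)).length
    have h6 := mul_logb_add_mul_logb_ge (x := (a : ℝ) + 1) (y := (b : ℝ) + 1)
      (by positivity) (by positivity)
    have e : (a : ℝ) + 1 + ((b : ℝ) + 1) = ((a + (b + 1) : ℕ) : ℝ) + 1 := by
      push_cast
      ring
    rw [e] at h6
    have h3' : 4 * (crossCount A (xs.filter (A v)) (xs.filter fun u => A u v) : ℝ) +
      (((a + (b + 1) : ℕ) : ℝ) - 1) * ((a + (b + 1) : ℕ) - 2) ≤ 6 * a * b := by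
      exact_mod_cast h3
    have h5' : (crossCount A (xs.filter fun u => A u v) (xs.filter (A v)) : ℝ) +
      crossCount A (xs.filter (A v)) (xs.filter fun u => A u v) = a * b := by
      exact_mod_cast h5
    -- With the logarithmic terms as atoms, the linear parts cancel and the only slack left is (l -
    -- r)².
    generalize (((a + (b + 1) : ℕ) : ℝ) + 1) * Real.logb 2 (((a + (b + 1) : ℕ) : ℝ) + 1) = X at *
    push_cast at *
    nlinarith [sq_nonneg ((a : ℝ) - b)]

theorem shortcut_bound_numeric (n : ℕ) (hn : 1 ≤ n) (s : ℝ)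
    (h : (n : ℝ) * (n - 1) + ((n : ℝ) + 1) * Real.logb 2 (n + 1) - 2 * n ≤ 4 * (s + (n - 1))) :
    (n.choose 2 : ℝ) / 2 + (n * Real.log n) / 5 - 3122 ≤ s := by
  have hn' : (1 : ℝ) ≤ n := by exact_mod_cast hn
  rw [Nat.cast_choose_two]
  -- The constant 1.4 is a lower estimate of 1/ln 2. After division by 4 it leaves 0.15 n ln n
  -- beyond the required n ln n / 5.
  have h1 : (n : ℝ) * (1.4 * Real.log n) ≤ ((n : ℝ) + 1) * Real.logb 2 (n + 1) := by
    have hl : Real.log n ≤ Real.log (n + 1) := Real.log_le_log (by linarith) (by linarith)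
    have hl0 : 0 ≤ Real.log n := Real.log_nonneg hn'
    have h2 : 0 < Real.log 2 := Real.log_pos (by norm_num)
    have hb : 1.4 * Real.log n ≤ Real.logb 2 (n + 1) := by
      rw [Real.logb, le_div_iff₀ h2]
      have := Real.log_two_lt_d9
      nlinarith
    exact mul_le_mul (by linarith) hb (by positivity) (by linarith)
  -- The surplus 0.15 n ln n must pay for a loss of 3n/2, hence the factor 10. It comes from log y ≤
  -- y - 1 at y = e⁹/n, and 8104 bounds e⁹.
  have h2 : 10 * (n : ℝ) - 8104 ≤ n * Real.log n := by
    have hx : Real.log (Real.exp 9 / n) ≤ Real.exp 9 / n - 1 :=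
      Real.log_le_sub_one_of_pos (by positivity)
    rw [Real.log_div (Real.exp_pos _).ne' (by linarith), Real.log_exp] at hx
    have he : Real.exp 9 ≤ 8104 := by
      have h3 := Real.exp_one_lt_d9
      have : Real.exp 9 = Real.exp 1 ^ 9 := by
        rw [← Real.exp_nat_mul]
        norm_num
      rw [this]
      calc Real.exp 1 ^ 9 ≤ 2.7182818286 ^ 9 := by gcongr
        _ ≤ 8104 := by norm_num
    have hm : (n : ℝ) * (Real.exp 9 / n) = Real.exp 9 := by
      field_simp
    nlinarith
  nlinarith

end Pivot

/-! ### Random tournaments -/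

section Discrepancy

variable {V : Type*}

/-- The number of pairs in `S ×ˢ T` that are related by `A`, minus the number of other pairs. -/
def discrepancy (A : V → V → Bool) (S T : Finset V) : ℝ :=
  ∑ x ∈ S ×ˢ T, if A x.1 x.2 then 1 else -1

theorem crossCount_eq_discrepancy [DecidableEq V] (A : V → V → Bool) {l r : List V} (hl : l.Nodup)
    (hr : r.Nodup) : 2 * (crossCount A l r : ℝ) =
      l.length * r.length + discrepancy A l.toFinset r.toFinset := by
  rw [discrepancy, Finset.sum_product, List.sum_toFinset _ hl]
  have h1 : ∀ x, ∑ y ∈ r.toFinset, (if A x y then (1 : ℝ) else -1) =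
      2 * r.countP (A x) - r.length := by
    intro x
    rw [List.sum_toFinset _ hr]
    clear hr
    induction r with
    | nil => simp
    | cons y r ih =>
      simp only [List.map_cons, List.sum_cons, List.countP_cons, List.length_cons, ih]
      split_ifs <;> push_cast <;> ring
  simp only [h1]
  clear hl
  induction l with
  | nil => simp [crossCount]
  | cons x l ih =>
    simp only [List.map_cons, List.sum_cons, crossCount_cons_left, List.length_cons]
    push_cast
    linarith

theorem two_mul_fwdCount_le (A : V → V → Bool) (p : List V) :
    2 * (fwdCount A p : ℝ) ≤ p.length * (p.length - 1) := by
  induction p with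
  | nil => simp [fwdCount]
  | cons x p ih =>
    have : (p.countP (A x) : ℝ) ≤ p.length := by exact_mod_cast List.countP_le_length
    simp only [fwdCount, List.length_cons]
    push_cast
    nlinarith

variable [Fintype V]

/-- The vertices `u` such that `u` is an out-neighbor of `v` for all `(v, true)` in `p`, and an
in-neighbor of `v` for all `(v, false)` in `p`. -/
def pathSet (A : V → V → Bool) (p : List (V × Bool)) : Finset V :=
  Finset.univ.filter fun u => ∀ q ∈ p, (if q.2 then A q.1 u else A u q.1) = true

theorem mem_pathSet {A : V → V → Bool} {p : List (V × Bool)} {u : V} :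
    u ∈ pathSet A p ↔ ∀ q ∈ p, (if q.2 then A q.1 u else A u q.1) = true := by
  simp [pathSet]

theorem mem_pathSet_cons {A : V → V → Bool} {p : List (V × Bool)} {q : V × Bool} {u : V} :
    u ∈ pathSet A (q :: p) ↔ (if q.2 then A q.1 u else A u q.1) = true ∧ u ∈ pathSet A p := by
  simp [pathSet]

theorem notMem_pathSet {A : V → V → Bool} (hA : IsTournamentRel A) {p : List (V × Bool)} {u : V}
    (hu : u ∈ p.map Prod.fst) : u ∉ pathSet A p := by
  intro h
  obtain ⟨q, hq, rfl⟩ := List.mem_map.1 hu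
  have := mem_pathSet.1 h q hq
  simp [hA.1] at this

/-- If the discrepancies between the two sides of every pivot are small, then no shortcut tree has
many more forward edges than one half. -/
theorem fwdCount_shortcutTree_le [DecidableEq V] {G : Digraph V} {A : V → V → Bool} (hA : IsTournamentRel A)
    (hG : ∀ x y, A x y = true ↔ G.Adj x y) {K : ℕ} {L w : ℝ} (hL : 0 ≤ L) (hw : 0 ≤ w)
    (h₁ : ∀ p : List (V × Bool), p.length = K → (p.map Prod.fst).Nodup →
      ((pathSet A p).card : ℝ) ≤ w)
    (h₂ : ∀ (p : List (V × Bool)) (v : V), p.length < K →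
      discrepancy A (pathSet A ((v, false) :: p)) (pathSet A ((v, true) :: p)) ≤
        2 * L * ((pathSet A ((v, false) :: p)).card + (pathSet A ((v, true) :: p)).card))
    (T : BinaryTree V) (hT : G.IsShortcutTree T) (p : List (V × Bool)) (hp : p.length ≤ K)
    (hpn : (p.map Prod.fst).Nodup) (hn : T.inorder.Nodup)
    (hTp : T.inorder.toFinset = pathSet A p) :
    4 * (fwdCount A T.inorder : ℝ) ≤ T.inorder.length * (T.inorder.length - 1) +
      ((K - p.length : ℕ) * (4 * L + 2) + w) * T.inorder.length := by
  induction T generalizing p with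
  | nil => simp [BinaryTree.inorder, fwdCount]
  | node v l r ihl ihr =>
    rcases hp.eq_or_lt with hpK | hpK
    -- At depth K all edges may be forward: the set has at most w vertices, so the excess over one
    -- half is absorbed by the term with w.
    · have h3 := two_mul_fwdCount_le A (BinaryTree.node v l r).inorder
      have h4 := h₁ p hpK hpn
      rw [← hTp, List.toFinset_card_of_nodup hn] at h4
      rw [hpK, Nat.sub_self]
      have h5 : (0 : ℝ) ≤ (BinaryTree.node v l r).inorder.length := Nat.cast_nonneg _
      push_cast
      nlinarith
    · obtain ⟨hl, hr, hsl, hsr⟩ := hT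
      rw [BinaryTree.inorder] at hn hTp ⊢
      rw [List.nodup_append, List.nodup_cons] at hn
      obtain ⟨hnl, ⟨hvr, hnr⟩, hlr⟩ := hn
      have hvl : v ∉ l.inorder := fun hv => hlr v hv v List.mem_cons_self rfl
      have hv : v ∈ pathSet A p := by
        rw [← hTp]
        simp
      have hvp : v ∉ p.map Prod.fst := fun h => notMem_pathSet hA h hv
      have key : ∀ u, u ∈ pathSet A p ↔ u ∈ l.inorder ∨ u = v ∨ u ∈ r.inorder := by
        intro u
        rw [← hTp]
        simp [or_left_comm]
      have hvl' : ∀ x ∈ l.inorder, A x v = true := fun x hx => (hG _ _).2 (hl x hx)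
      have hvr' : ∀ x ∈ r.inorder, A v x = true := fun x hx => (hG _ _).2 (hr x hx)
      have hne : ∀ x, A x v = true → A v x = true → False := by
        intro x h1 h2
        by_cases hx : x = v
        · subst hx
          simp [hA.1] at h1
        · simp [hA.2 x v hx, h2] at h1
      -- A vertex of the subtree other than `v` lies on the side dictated by its edge to `v`, so the
      -- left subtree consists of all in-neighbours of `v` in the current set.
      have hTl : l.inorder.toFinset = pathSet A ((v, false) :: p) := by
        ext u
        rw [List.mem_toFinset, mem_pathSet_cons, key]
        simp only [Bool.false_eq_true, if_false]
        constructor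
        · exact fun h => ⟨hvl' u h, Or.inl h⟩
        · rintro ⟨h1, h2 | rfl | h2⟩
          · exact h2
          · simp [hA.1] at h1
          · exact (hne u h1 (hvr' u h2)).elim
      have hTr : r.inorder.toFinset = pathSet A ((v, true) :: p) := by
        ext u
        rw [List.mem_toFinset, mem_pathSet_cons, key]
        simp only [if_true]
        constructor
        · exact fun h => ⟨hvr' u h, Or.inr (Or.inr h)⟩
        · rintro ⟨h1, h2 | rfl | h2⟩
          · exact (hne u (hvl' u h2) h1).elim
          · simp [hA.1] at h1
          · exact h2
      have i1 := ihl hsl ((v, false) :: p) hpK (List.nodup_cons.2 ⟨hvp, hpn⟩) hnl hTl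
      have i2 := ihr hsr ((v, true) :: p) hpK (List.nodup_cons.2 ⟨hvp, hpn⟩) hnr hTr
      have i3 := h₂ p v hpK
      have i4 := crossCount_eq_discrepancy A hnl hnr
      rw [hTl, hTr] at i4
      rw [← hTl, List.toFinset_card_of_nodup hnl, ← hTr, List.toFinset_card_of_nodup hnr] at i3
      rw [hTl, hTr] at i3
      rw [fwdCount_node A _ _ v hvl' hvr']
      simp only [List.length_cons, List.length_append] at i1 i2 ⊢
      obtain ⟨c, hc⟩ : ∃ c, K - p.length = c + 1 := ⟨K - p.length - 1, by omega⟩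
      have hc' : K - (p.length + 1) = c := by omega
      rw [hc'] at i1 i2
      rw [hc]
      push_cast at i1 i2 ⊢
      have hc0 : (0 : ℝ) ≤ c := Nat.cast_nonneg _
      have : 0 ≤ ((c : ℝ) + 1) * (4 * L + 2) + w := by positivity
      -- One level costs 4L + 2 per vertex: 4L is the allowed discrepancy, and 2 remains of the 4(l
      -- + r) for the edges at the root after comparing m(m-1) with (l+r)² - (l+r).
      nlinarith

end Discrepancy

/-! ### Fair coins: probabilities as proportions of coin assignments -/

section Random

variable {n : ℕ}

/-- The tournament given by a truth value for each pair of vertices. -/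
def coinRel (ω : Sym2 (Fin n) → Bool) (i j : Fin n) : Bool :=
  decide (i ≠ j) && (ω s(i, j) == decide (i < j))

theorem coinRel_isTournamentRel (ω : Sym2 (Fin n) → Bool) : IsTournamentRel (coinRel ω) := by
  refine ⟨fun x => by simp [coinRel], fun x y hxy => ?_⟩
  simp only [coinRel, Sym2.eq_swap (a := y)]
  rcases lt_or_gt_of_ne hxy with h | h
  · simp [hxy, hxy.symm, h, h.not_gt]
  · simp [hxy, hxy.symm, h, h.not_gt]

theorem coinRel_congr {ω ω' : Sym2 (Fin n) → Bool} {i j : Fin n} (h : ω s(i, j) = ω' s(i, j)) :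
    coinRel ω i j = coinRel ω' i j := by
  rw [coinRel, coinRel, h]

theorem eq_of_coinRel {ω ω' : Sym2 (Fin n) → Bool} {i j : Fin n} (h : coinRel ω i j = true)
    (h' : coinRel ω' i j = true) : ω s(i, j) = ω' s(i, j) := by
  simp only [coinRel, Bool.and_eq_true, beq_iff_eq] at h h'
  rw [h.2, h'.2]

theorem pair_injOn {S T : Finset (Fin n)} (h : Disjoint S T) :
    Set.InjOn (fun x : Fin n × Fin n => s(x.1, x.2)) (S ×ˢ T : Finset (Fin n × Fin n)) := by
  rintro ⟨a, b⟩ hab ⟨c, d⟩ hcd e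
  simp only [Finset.coe_product, Set.mem_prod, Finset.mem_coe] at hab hcd
  simp only [Sym2.eq_iff] at e
  rcases e with ⟨rfl, rfl⟩ | ⟨rfl, rfl⟩
  · rfl
  · exact (Finset.disjoint_left.1 h hab.1 hcd.2).elim

/-- The coins in `S` are prescribed and the others are free, so the assignments form a product set.
-/
theorem card_forced_mul {ι : Type*} [Fintype ι] [DecidableEq ι] (S : Finset ι) (τ : ι → Bool) :
    (Finset.univ.filter fun ω : ι → Bool => ∀ e ∈ S, ω e = τ e).card * 2 ^ S.card =
      Fintype.card (ι → Bool) := by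
  have h1 : (Finset.univ.filter fun ω : ι → Bool => ∀ e ∈ S, ω e = τ e) =
      Fintype.piFinset fun e => if e ∈ S then {τ e} else Finset.univ := by
    ext ω
    simp only [Finset.mem_filter, Finset.mem_univ, true_and, Fintype.mem_piFinset]
    refine forall_congr' fun e => ?_
    by_cases he : e ∈ S <;> simp [he]
  rw [h1, Fintype.card_piFinset, Fintype.card_pi]
  have h2 : 2 ^ S.card = ∏ e : ι, if e ∈ S then 2 else 1 := by
    rw [Finset.prod_ite_mem]
    simp
  rw [h2, ← Finset.prod_mul_distrib]
  refine Finset.prod_congr rfl fun e _ => ?_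
  by_cases he : e ∈ S <;> simp [he]

/-- Membership in the path set prescribes one coin for each pair of a path vertex and a vertex of
`U`. These pairs are distinct because `U` avoids the path, or else the event is empty. -/
theorem card_subset_pathSet_le (p : List (Fin n × Bool)) (hp : (p.map Prod.fst).Nodup)
    (U : Finset (Fin n)) :
    (Finset.univ.filter fun ω : Sym2 (Fin n) → Bool => U ⊆ pathSet (coinRel ω) p).card *
      2 ^ (p.length * U.card) ≤ Fintype.card (Sym2 (Fin n) → Bool) := by
  -- If the event occurs at all, any assignment `τ` in it supplies the prescribed coin values.
  rcases Finset.eq_empty_or_nonempty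
    (Finset.univ.filter fun ω : Sym2 (Fin n) → Bool => U ⊆ pathSet (coinRel ω) p) with h | ⟨τ, hτ⟩
  · rw [h]
    simp
  have hτ' := (Finset.mem_filter.1 hτ).2
  set P := (p.map Prod.fst).toFinset with hP
  have hPc : P.card = p.length := by
    rw [hP, List.toFinset_card_of_nodup hp, List.length_map]
  have hd : Disjoint P U := by
    rw [Finset.disjoint_left]
    intro x hx hxU
    exact notMem_pathSet (coinRel_isTournamentRel τ) (List.mem_toFinset.1 hx) (hτ' hxU)
  set S := (P ×ˢ U).image fun x : Fin n × Fin n => s(x.1, x.2) with hS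
  have hSc : S.card = p.length * U.card := by
    rw [hS, Finset.card_image_of_injOn (pair_injOn hd), Finset.card_product, hPc]
  rw [← hSc, ← card_forced_mul S τ]
  refine Nat.mul_le_mul_right _ (Finset.card_le_card fun ω hω => ?_)
  simp only [Finset.mem_filter, Finset.mem_univ, true_and] at hω ⊢
  intro e he
  rw [hS, Finset.mem_image] at he
  obtain ⟨⟨x, u⟩, hxu, rfl⟩ := he
  rw [Finset.mem_product] at hxu
  obtain ⟨q, hq, rfl⟩ := List.mem_map.1 (List.mem_toFinset.1 hxu.1)
  have e1 := mem_pathSet.1 (hω hxu.2) q hq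
  have e2 := mem_pathSet.1 (hτ' hxu.2) q hq
  by_cases hq2 : q.2 = true
  · simp only [hq2, if_true] at e1 e2
    exact eq_of_coinRel e1 e2
  · simp only [hq2] at e1 e2
    rw [Sym2.eq_swap]
    exact eq_of_coinRel e1 e2

/-- The exponential moment of the discrepancy between two fixed sets, the edges that touch a third
set being fixed. -/
theorem sum_exp_discrepancy_le {E : Finset (Sym2 (Fin n))} {S T : Finset (Fin n)}
    (hST : Disjoint S T) (hE : ∀ x ∈ S, ∀ y ∈ T, s(x, y) ∉ E) (τ : Sym2 (Fin n) → Bool) (t : ℝ) :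
    ∑ ω : Sym2 (Fin n) → Bool with ∀ e ∈ E, ω e = τ e,
        Real.exp (t * discrepancy (coinRel ω) S T) ≤
      (Finset.univ.filter fun ω : Sym2 (Fin n) → Bool => ∀ e ∈ E, ω e = τ e).card *
        Real.exp (t ^ 2 / 2 * (S.card * T.card)) := by
  have h1 : (Finset.univ.filter fun ω : Sym2 (Fin n) → Bool => ∀ e ∈ E, ω e = τ e) =
      Fintype.piFinset fun e => if e ∈ E then {τ e} else Finset.univ := by
    ext ω
    simp only [Finset.mem_filter, Finset.mem_univ, true_and, Fintype.mem_piFinset]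
    refine forall_congr' fun e => ?_
    by_cases he : e ∈ E <;> simp [he]
  rw [h1]
  -- `f e` is the factor that the coin of `e` contributes to the exponential. It is 1 unless `e`
  -- joins `S` to `T`, so the sum over assignments factors over the pairs.
  set f : Sym2 (Fin n) → Bool → ℝ := fun e b =>
    ∏ x ∈ S ×ˢ T with s(x.1, x.2) = e, Real.exp (t * if b = decide (x.1 < x.2) then 1 else -1)
    with hf
  have h2 : ∀ ω : Sym2 (Fin n) → Bool,
      Real.exp (t * discrepancy (coinRel ω) S T) = ∏ e, f e (ω e) := by
    intro ω
    have : ∏ e, f e (ω e) = ∏ e, ∏ x ∈ S ×ˢ T with s(x.1, x.2) = e,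
        Real.exp (t * if ω s(x.1, x.2) = decide (x.1 < x.2) then 1 else -1) := by
      refine Finset.prod_congr rfl fun e _ => ?_
      refine Finset.prod_congr rfl fun x hx => ?_
      rw [(Finset.mem_filter.1 hx).2]
    rw [this, Finset.prod_fiberwise, discrepancy, Finset.mul_sum, Real.exp_sum]
    refine Finset.prod_congr rfl fun x hx => ?_
    rw [Finset.mem_product] at hx
    have hne : x.1 ≠ x.2 := fun h => Finset.disjoint_left.1 hST hx.1 (h ▸ hx.2)
    simp [coinRel, hne]
  rw [Finset.sum_congr rfl fun ω _ => h2 ω, ← Finset.prod_univ_sum, Fintype.card_piFinset,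
    Nat.cast_prod]
  have h3 : Real.exp (t ^ 2 / 2 * (S.card * T.card)) = ∏ e : Sym2 (Fin n),
      ∏ x ∈ S ×ˢ T with s(x.1, x.2) = e, Real.exp (t ^ 2 / 2) := by
    rw [Finset.prod_fiberwise, Finset.prod_const, ← Real.exp_nat_mul, Finset.card_product]
    congr 1
    push_cast
    ring
  rw [h3, ← Finset.prod_mul_distrib]
  refine Finset.prod_le_prod (fun e _ => Finset.sum_nonneg fun b _ =>
    Finset.prod_nonneg fun x _ => (Real.exp_pos _).le) fun e _ => ?_
  rcases Finset.eq_empty_or_nonempty ((S ×ˢ T).filter fun x => s(x.1, x.2) = e) with h | ⟨x, hx⟩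
  · simp [hf, h]
  have hs : ((S ×ˢ T).filter fun x => s(x.1, x.2) = e) = {x} := by
    refine Finset.eq_singleton_iff_unique_mem.2 ⟨hx, fun y hy => ?_⟩
    rw [Finset.mem_filter] at hx hy
    exact pair_injOn hST (Finset.mem_coe.2 hy.1) (Finset.mem_coe.2 hx.1) (hy.2.trans hx.2.symm)
  have heE : e ∉ E := by
    rw [Finset.mem_filter, Finset.mem_product] at hx
    exact hx.2 ▸ hE _ hx.1.1 _ hx.1.2
  simp only [hf, hs, Finset.prod_singleton, heE, if_false, Finset.card_univ, Fintype.card_bool,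
    Fintype.sum_bool]
  -- For a free coin the two outcomes contribute exp t + exp (-t), that is, twice cosh t.
  have hcosh := Real.cosh_le_exp_half_sq t
  rw [Real.cosh_eq] at hcosh
  by_cases hlt : x.1 < x.2
  · simp [hlt]
    linarith
  · simp [hlt]
    linarith

/-- Chernoff's method: Markov's inequality applied to the exponential moment, with the coins in `E`
held fixed. -/
theorem card_discrepancy_gt_le {E : Finset (Sym2 (Fin n))} {S T : Finset (Fin n)}
    (hST : Disjoint S T) (hE : ∀ x ∈ S, ∀ y ∈ T, s(x, y) ∉ E) (τ : Sym2 (Fin n) → Bool) {L : ℝ}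
    (hL : 0 ≤ L) :
    ((Finset.univ.filter fun ω : Sym2 (Fin n) → Bool => (∀ e ∈ E, ω e = τ e) ∧
        2 * L * (S.card + T.card) < discrepancy (coinRel ω) S T).card : ℝ) ≤
      (Finset.univ.filter fun ω : Sym2 (Fin n) → Bool => ∀ e ∈ E, ω e = τ e).card *
        Real.exp (-(8 * L ^ 2)) := by
  rcases Nat.eq_zero_or_pos (S.card + T.card) with h0 | h0
  · have hS : S = ∅ := Finset.card_eq_zero.1 (by omega)
    have : (Finset.univ.filter fun ω : Sym2 (Fin n) → Bool => (∀ e ∈ E, ω e = τ e) ∧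
        2 * L * (S.card + T.card) < discrepancy (coinRel ω) S T) = ∅ := by
      refine Finset.filter_eq_empty_iff.2 fun ω _ h => ?_
      have h2 := h.2
      have h0' : ((S.card : ℝ) + T.card) = 0 := by exact_mod_cast h0
      rw [h0', discrepancy, hS] at h2
      simp at h2
    rw [this]
    simp only [Finset.card_empty, Nat.cast_zero]
    positivity
  have hc : (0 : ℝ) < (S.card : ℝ) + T.card := by exact_mod_cast h0
  set c : ℝ := (S.card : ℝ) + T.card with hcdef
  -- This `t` is optimal once |S||T| is replaced by its bound c²/4: the moment is at most exp(8L²)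
  -- and the threshold gives exp(16L²).
  set t : ℝ := 8 * L / c with ht
  have ht0 : 0 ≤ t := by positivity
  have h1 := sum_exp_discrepancy_le hST hE τ t
  have h2 : ((Finset.univ.filter fun ω : Sym2 (Fin n) → Bool => (∀ e ∈ E, ω e = τ e) ∧
        2 * L * c < discrepancy (coinRel ω) S T).card : ℝ) * Real.exp (16 * L ^ 2) ≤
      ∑ ω : Sym2 (Fin n) → Bool with ∀ e ∈ E, ω e = τ e,
        Real.exp (t * discrepancy (coinRel ω) S T) := by
    rw [← nsmul_eq_mul, ← Finset.sum_const]
    refine (Finset.sum_le_sum fun ω hω => ?_).trans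
      (Finset.sum_le_sum_of_subset_of_nonneg ?_ fun _ _ _ => (Real.exp_pos _).le)
    · rw [Real.exp_le_exp]
      have h3 := (Finset.mem_filter.1 hω).2.2
      have h4 : t * (2 * L * c) = 16 * L ^ 2 := by
        rw [ht]
        field_simp
        ring
      rw [← h4]
      exact mul_le_mul_of_nonneg_left h3.le ht0
    · exact Finset.monotone_filter_right _ fun ω _ h => h.1
  have h3 : Real.exp (t ^ 2 / 2 * (S.card * T.card)) ≤ Real.exp (8 * L ^ 2) := by
    rw [Real.exp_le_exp]
    have h4 : t ^ 2 * c ^ 2 = 64 * L ^ 2 := by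
      rw [ht]
      field_simp
      ring
    have h5 : 4 * ((S.card : ℝ) * T.card) ≤ c ^ 2 := by
      rw [hcdef]
      nlinarith [sq_nonneg ((S.card : ℝ) - T.card)]
    nlinarith [mul_le_mul_of_nonneg_left h5 (sq_nonneg t)]
  have h4 := (h2.trans h1).trans (mul_le_mul_of_nonneg_left h3 (Nat.cast_nonneg _))
  have h5 : Real.exp (16 * L ^ 2) = Real.exp (8 * L ^ 2) * Real.exp (8 * L ^ 2) := by
    rw [← Real.exp_add]
    ring_nf
  rw [Real.exp_neg, ← div_eq_mul_inv, le_div_iff₀ (Real.exp_pos _)]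
  rw [h5, ← mul_assoc] at h4
  exact le_of_mul_le_mul_right h4 (Real.exp_pos _)

/-- The two sets depend on the coins, but only on pairs that meet the path or `v`. Conditioning on
those pairs freezes both sets, while the coins between them stay independent, since neither set
contains a vertex of the path or `v`. -/
theorem card_pathSet_discrepancy_gt_le (p : List (Fin n × Bool)) (v : Fin n) {L : ℝ}
    (hL : 0 ≤ L) :
    ((Finset.univ.filter fun ω : Sym2 (Fin n) → Bool =>
        2 * L * ((pathSet (coinRel ω) ((v, false) :: p)).card +
            (pathSet (coinRel ω) ((v, true) :: p)).card) <
          discrepancy (coinRel ω) (pathSet (coinRel ω) ((v, false) :: p))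
            (pathSet (coinRel ω) ((v, true) :: p))).card : ℝ) ≤
      Fintype.card (Sym2 (Fin n) → Bool) * Real.exp (-(8 * L ^ 2)) := by
  set P : List (Fin n) := v :: p.map Prod.fst with hP
  set E : Finset (Sym2 (Fin n)) := Finset.univ.filter fun e => ∃ x ∈ P, x ∈ e with hE
  -- The fibres of `ρ` are the classes of assignments that agree on `E`; the estimate is proved on
  -- each fibre and summed.
  set ρ : (Sym2 (Fin n) → Bool) → Sym2 (Fin n) → Bool := fun ω e =>
    if e ∈ E then ω e else false with hρ
  have hρ_iff : ∀ ω τ, ρ ω = ρ τ ↔ ∀ e ∈ E, ω e = τ e := by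
    intro ω τ
    constructor
    · intro h e he
      have := congrFun h e
      simpa [hρ, he] using this
    · intro h
      funext e
      by_cases he : e ∈ E
      · simp [hρ, he, h e he]
      · simp [hρ, he]
  have hset : ∀ ω τ, (∀ e ∈ E, ω e = τ e) → ∀ b,
      pathSet (coinRel ω) ((v, b) :: p) = pathSet (coinRel τ) ((v, b) :: p) := by
    intro ω τ h b
    ext u
    simp only [mem_pathSet]
    refine forall_congr' fun q => forall_congr' fun hq => ?_
    have hqP : q.1 ∈ P := by
      rcases List.mem_cons.1 hq with rfl | hq
      · exact List.mem_cons_self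
      · exact List.mem_cons_of_mem _ (List.mem_map_of_mem hq)
    rw [coinRel_congr (h s(q.1, u) (by
        rw [hE, Finset.mem_filter]
        exact ⟨Finset.mem_univ _, q.1, hqP, Sym2.mem_mk_left _ _⟩)),
      coinRel_congr (h s(u, q.1) (by
        rw [hE, Finset.mem_filter]
        exact ⟨Finset.mem_univ _, q.1, hqP, Sym2.mem_mk_right _ _⟩))]
  have hcard : (Fintype.card (Sym2 (Fin n) → Bool) : ℝ) =
      ∑ σ ∈ Finset.univ.image ρ, ((Finset.univ.filter fun ω => ρ ω = σ).card : ℝ) := by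
    rw [← Finset.card_univ, Finset.card_eq_sum_card_image ρ]
    push_cast
    rfl
  rw [Finset.card_eq_sum_card_fiberwise (f := ρ) (t := Finset.univ.image ρ)
    (fun ω _ => Finset.mem_coe.2 (Finset.mem_image_of_mem _ (Finset.mem_univ _))), hcard,
    Finset.sum_mul]
  push_cast
  refine Finset.sum_le_sum fun σ hσ => ?_
  obtain ⟨τ, -, rfl⟩ := Finset.mem_image.1 hσ
  simp only [hρ_iff]
  have hrel := coinRel_isTournamentRel τ
  have hmem : ∀ b u, u ∈ pathSet (coinRel τ) ((v, b) :: p) → u ∉ P := by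
    intro b u hu huP
    exact notMem_pathSet hrel (p := (v, b) :: p) (by simpa [hP] using huP) hu
  have hmain := card_discrepancy_gt_le (E := E) (S := pathSet (coinRel τ) ((v, false) :: p))
    (T := pathSet (coinRel τ) ((v, true) :: p)) (by
      rw [Finset.disjoint_left]
      intro u h1 h2
      rw [mem_pathSet_cons] at h1 h2
      simp only [Bool.false_eq_true, if_false, if_true] at h1 h2
      by_cases huv : u = v
      · subst huv
        simp [hrel.1] at h1
      · simp [hrel.2 u v huv, h2.1] at h1) (by
      intro x hx y hy hxy
      rw [hE, Finset.mem_filter] at hxy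
      obtain ⟨-, z, hz, hz'⟩ := hxy
      rcases Sym2.mem_iff.1 hz' with rfl | rfl
      · exact hmem _ _ hx hz
      · exact hmem _ _ hy hz) τ hL
  refine le_trans ?_ hmain
  refine Nat.cast_le.2 (Finset.card_le_card fun ω hω => ?_)
  simp only [Finset.mem_filter, Finset.mem_univ, true_and] at hω ⊢
  refine ⟨hω.2, ?_⟩
  rw [← hset ω τ hω.2, ← hset ω τ hω.2]
  exact hω.1

end Random

/-! ### The upper bound -/

section UpperBound

/-- A union bound over two families of bad events: a long path together with a set of 2ℓ + 4
vertices inside its path set, and a shorter path with a pivot of large discrepancy. They cover at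
most 1/4 and 1/2 of all assignments, so a good one exists. -/
theorem exists_good_coins {n : ℕ} {ℓ : ℕ} (hℓ : 1 ≤ ℓ) (hn : n ≤ 2 ^ ℓ) :
    ∃ ω : Sym2 (Fin n) → Bool,
      (∀ p : List (Fin n × Bool), p.length = 2 * ℓ → (p.map Prod.fst).Nodup →
        (pathSet (coinRel ω) p).card ≤ 2 * ℓ + 3) ∧
      (∀ (p : List (Fin n × Bool)) (v : Fin n), p.length < 2 * ℓ →
        discrepancy (coinRel ω) (pathSet (coinRel ω) ((v, false) :: p))
            (pathSet (coinRel ω) ((v, true) :: p)) ≤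
          2 * (ℓ : ℝ) * ((pathSet (coinRel ω) ((v, false) :: p)).card +
            (pathSet (coinRel ω) ((v, true) :: p)).card)) := by
  classical
  by_contra! hcon
  set N : ℝ := ((Fintype.card (Sym2 (Fin n) → Bool) : ℕ) : ℝ) with hN
  have hN0 : 0 < N := by
    rw [hN]
    exact_mod_cast Fintype.card_pos
  set bad₁ : (Fin (2 * ℓ) → Fin n × Bool) × Finset (Fin n) → Finset (Sym2 (Fin n) → Bool) :=
    fun x => Finset.univ.filter fun ω => x.2 ⊆ pathSet (coinRel ω) (List.ofFn x.1) with hbad₁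
  set I₁ : Finset ((Fin (2 * ℓ) → Fin n × Bool) × Finset (Fin n)) :=
    (Finset.univ.filter fun f => ((List.ofFn f).map Prod.fst).Nodup) ×ˢ
      Finset.univ.powersetCard (2 * ℓ + 4) with hI₁
  set bad₂ : (Σ k : Fin (2 * ℓ), (Fin k → Fin n × Bool) × Fin n) →
      Finset (Sym2 (Fin n) → Bool) := fun x => Finset.univ.filter fun ω =>
    2 * (ℓ : ℝ) * ((pathSet (coinRel ω) ((x.2.2, false) :: List.ofFn x.2.1)).card +
            (pathSet (coinRel ω) ((x.2.2, true) :: List.ofFn x.2.1)).card) <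
          discrepancy (coinRel ω) (pathSet (coinRel ω) ((x.2.2, false) :: List.ofFn x.2.1))
            (pathSet (coinRel ω) ((x.2.2, true) :: List.ofFn x.2.1)) with hbad₂
  have hcover : (Finset.univ : Finset (Sym2 (Fin n) → Bool)) ⊆
      I₁.biUnion bad₁ ∪ Finset.univ.biUnion bad₂ := by
    intro ω _
    rw [Finset.mem_union]
    by_cases h1 : ∀ p : List (Fin n × Bool), p.length = 2 * ℓ → (p.map Prod.fst).Nodup →
        (pathSet (coinRel ω) p).card ≤ 2 * ℓ + 3
    · right
      obtain ⟨p, v, hp, hlt⟩ := hcon ω h1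
      rw [Finset.mem_biUnion]
      refine ⟨⟨⟨p.length, hp⟩, p.get, v⟩, Finset.mem_univ _, ?_⟩
      rw [hbad₂, Finset.mem_filter]
      refine ⟨Finset.mem_univ _, ?_⟩
      simpa using hlt
    · left
      push Not at h1
      obtain ⟨p, hp, hpn, hlt⟩ := h1
      obtain ⟨U, hU, hUc⟩ := Finset.exists_subset_card_eq
        (show 2 * ℓ + 4 ≤ (pathSet (coinRel ω) p).card by omega)
      rw [Finset.mem_biUnion]
      have hof : List.ofFn (fun i : Fin (2 * ℓ) => p.get (Fin.cast hp.symm i)) = p := by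
        have : ∀ m (h : p.length = m), List.ofFn (fun i : Fin m => p.get (Fin.cast h.symm i)) = p := by
          rintro m rfl
          simp
        exact this _ hp
      refine ⟨⟨fun i => p.get (Fin.cast hp.symm i), U⟩, ?_, ?_⟩
      · rw [hI₁, Finset.mem_product, Finset.mem_filter, Finset.mem_powersetCard]
        exact ⟨⟨Finset.mem_univ _, by rw [hof]; exact hpn⟩, Finset.subset_univ _, hUc⟩
      · rw [hbad₁, Finset.mem_filter]
        exact ⟨Finset.mem_univ _, by rw [hof]; exact hU⟩
  have hcard := (Finset.card_le_card hcover).trans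
    ((Finset.card_union_le _ _).trans (Nat.add_le_add Finset.card_biUnion_le
      Finset.card_biUnion_le))
  rw [Finset.card_univ] at hcard
  have hcard' : N ≤ ∑ x ∈ I₁, ((bad₁ x).card : ℝ) + ∑ x, ((bad₂ x).card : ℝ) := by
    rw [hN]
    exact_mod_cast hcard
  have hnR : (n : ℝ) ≤ 2 ^ ℓ := by exact_mod_cast hn
  have hb₁ : ∑ x ∈ I₁, ((bad₁ x).card : ℝ) ≤ N / 4 := by
    have e1 : ∀ x ∈ I₁, ((bad₁ x).card : ℝ) ≤ N / 2 ^ (2 * ℓ * (2 * ℓ + 4)) := by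
      intro x hx
      rw [hI₁, Finset.mem_product, Finset.mem_filter, Finset.mem_powersetCard] at hx
      have := card_subset_pathSet_le _ hx.1.2 x.2
      rw [List.length_ofFn, hx.2.2] at this
      rw [le_div_iff₀ (by positivity), hN]
      exact_mod_cast this
    have e2 : (I₁.card : ℝ) ≤ 2 ^ ((ℓ + 1) * (2 * ℓ) + ℓ * (2 * ℓ + 4)) := by
      have e3 : I₁.card ≤ (n * 2) ^ (2 * ℓ) * n ^ (2 * ℓ + 4) := by
        rw [hI₁, Finset.card_product, Finset.card_powersetCard]
        refine Nat.mul_le_mul ?_ ?_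
        · refine (Finset.card_filter_le _ _).trans ?_
          simp
        · simpa using Nat.choose_le_pow n (2 * ℓ + 4)
      have e4 : (n * 2) ^ (2 * ℓ) * n ^ (2 * ℓ + 4) ≤
          2 ^ ((ℓ + 1) * (2 * ℓ) + ℓ * (2 * ℓ + 4)) := by
        rw [pow_add 2, pow_mul 2 (ℓ + 1), pow_mul 2 ℓ]
        refine Nat.mul_le_mul (Nat.pow_le_pow_left ?_ _) (Nat.pow_le_pow_left hn _)
        rw [pow_succ]
        exact Nat.mul_le_mul_right _ hn
      exact_mod_cast e3.trans e4
    refine (Finset.sum_le_card_nsmul _ _ _ e1).trans ?_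
    rw [nsmul_eq_mul, mul_div_assoc', div_le_div_iff₀ (by positivity) (by norm_num)]
    -- The exponents are 4ℓ² + 6ℓ for the choices and 4ℓ² + 8ℓ for the forced coins; the difference
    -- 2ℓ is at least 2.
    have e5 : (2 : ℝ) ^ ((ℓ + 1) * (2 * ℓ) + ℓ * (2 * ℓ + 4)) * 4 ≤
        2 ^ (2 * ℓ * (2 * ℓ + 4)) := by
      have : (4 : ℝ) = 2 ^ 2 := by norm_num
      rw [this, ← pow_add]
      exact pow_le_pow_right₀ (by norm_num) (by nlinarith)
    nlinarith
  have hb₂ : ∑ x, ((bad₂ x).card : ℝ) ≤ N / 2 := by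
    have e1 : ∀ x ∈ Finset.univ, ((bad₂ x).card : ℝ) ≤ N * Real.exp (-(8 * (ℓ : ℝ) ^ 2)) :=
      fun x _ => card_pathSet_discrepancy_gt_le _ _ (Nat.cast_nonneg ℓ)
    have e2 : (Fintype.card (Σ k : Fin (2 * ℓ), (Fin k → Fin n × Bool) × Fin n) : ℝ) ≤
        2 ^ (7 * ℓ ^ 2) := by
      have e3 : Fintype.card (Σ k : Fin (2 * ℓ), (Fin k → Fin n × Bool) × Fin n) ≤
          2 ^ (7 * ℓ ^ 2) := by
        rw [Fintype.card_sigma]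
        have e4 : ∀ k ∈ (Finset.univ : Finset (Fin (2 * ℓ))),
            Fintype.card ((Fin k → Fin n × Bool) × Fin n) ≤ 2 ^ ((ℓ + 1) * (2 * ℓ - 1) + ℓ) := by
          intro k _
          simp only [Fintype.card_prod, Fintype.card_pi, Fintype.card_fin, Fintype.card_bool,
            Finset.prod_const, Finset.card_univ]
          rw [pow_add]
          refine Nat.mul_le_mul ?_ hn
          calc (n * 2) ^ (k : ℕ) ≤ (2 ^ (ℓ + 1)) ^ (k : ℕ) := by
                rw [pow_succ]
                gcongr
            _ = 2 ^ ((ℓ + 1) * k) := by rw [← pow_mul]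
            _ ≤ _ := Nat.pow_le_pow_right (by norm_num)
                (Nat.mul_le_mul_left _ (by omega))
        refine (Finset.sum_le_card_nsmul _ _ _ e4).trans ?_
        rw [Finset.card_univ, Fintype.card_fin, smul_eq_mul]
        calc 2 * ℓ * 2 ^ ((ℓ + 1) * (2 * ℓ - 1) + ℓ)
            ≤ 2 ^ (2 * ℓ) * 2 ^ ((ℓ + 1) * (2 * ℓ - 1) + ℓ) := by
              gcongr
              exact Nat.lt_two_pow_self.le
          _ = 2 ^ (2 * ℓ + ((ℓ + 1) * (2 * ℓ - 1) + ℓ)) := by rw [← pow_add]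
          _ ≤ _ := by
              refine Nat.pow_le_pow_right (by norm_num) ?_
              obtain ⟨m, rfl⟩ : ∃ m, ℓ = m + 1 := ⟨ℓ - 1, by omega⟩
              have : 2 * (m + 1) - 1 = 2 * m + 1 := by omega
              rw [this]
              nlinarith
      exact_mod_cast e3
    have e3 : (2 : ℝ) ^ (7 * ℓ ^ 2) ≤ Real.exp (7 * (ℓ : ℝ) ^ 2) := by
      have h2 : (2 : ℝ) ≤ Real.exp 1 := by
        have := Real.add_one_le_exp (1 : ℝ)
        linarith
      calc (2 : ℝ) ^ (7 * ℓ ^ 2) ≤ Real.exp 1 ^ (7 * ℓ ^ 2) := by gcongr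
        _ = _ := by
          rw [← Real.exp_nat_mul]
          push_cast
          ring_nf
    refine (Finset.sum_le_card_nsmul _ _ _ e1).trans ?_
    rw [nsmul_eq_mul, Finset.card_univ]
    -- The number of choices is at most exp(7ℓ²), each of probability at most exp(-8ℓ²), and exp(-1)
    -- ≤ 1/2.
    have e4 : Real.exp (7 * (ℓ : ℝ) ^ 2) * Real.exp (-(8 * (ℓ : ℝ) ^ 2)) ≤ 1 / 2 := by
      rw [← Real.exp_add]
      have h1 : (1 : ℝ) ≤ ℓ := by exact_mod_cast hℓ
      have h2 : 7 * (ℓ : ℝ) ^ 2 + -(8 * (ℓ : ℝ) ^ 2) ≤ -1 := by nlinarith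
      refine (Real.exp_le_exp.2 h2).trans ?_
      rw [Real.exp_neg, inv_le_comm₀ (Real.exp_pos _) (by norm_num)]
      have := Real.add_one_le_exp (1 : ℝ)
      norm_num at this ⊢
      linarith
    have e5 := mul_le_mul_of_nonneg_right (e2.trans e3)
      (Real.exp_pos (-(8 * (ℓ : ℝ) ^ 2))).le
    nlinarith
  linarith

theorem eventually_exists_few_shortcuts : ∀ᶠ n : ℕ in Filter.atTop,
    ∃ G : Digraph (Fin n), G.IsTournament ∧
      ∀ T : BinaryTree (Fin n), G.IsSpanningShortcutTree T →
        (G.numShortcuts T : ℝ) ≤ (n.choose 2 : ℝ) / 2 + 4 * n * (Real.logb 2 n) ^ 2 := by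
  -- From 16 on log₂ n ≥ 4, which suffices to absorb the lower-order terms and the rounding of ℓ
  -- into the leading constant.
  filter_upwards [Filter.eventually_ge_atTop 16] with n hn
  set ℓ := Nat.clog 2 n with hℓ
  have hn2 : n ≤ 2 ^ ℓ := Nat.le_pow_clog (by norm_num) n
  have hℓ1 : 1 ≤ ℓ := Nat.clog_pos (by norm_num) (by omega)
  have hlogℓ : (ℓ : ℝ) ≤ Real.logb 2 n + 1 := by
    have h1 : 2 ^ (ℓ - 1) < n := Nat.pow_pred_clog_lt_self (by norm_num) (by omega)
    have h2 : ((ℓ - 1 : ℕ) : ℝ) ≤ Real.logb 2 n := by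
      rw [Real.le_logb_iff_rpow_le (by norm_num) (by positivity), Real.rpow_natCast]
      exact_mod_cast h1.le
    rw [Nat.cast_sub hℓ1] at h2
    push_cast at h2
    linarith
  have hlog4 : 4 ≤ Real.logb 2 n := by
    rw [Real.le_logb_iff_rpow_le (by norm_num) (by positivity)]
    norm_num
    exact hn
  obtain ⟨ω, h₁, h₂⟩ := exists_good_coins hℓ1 hn2
  have hrel := coinRel_isTournamentRel ω
  refine ⟨⟨fun i j => coinRel ω i j = true⟩, ⟨fun v => by simp [hrel.1], fun u v huv => ?_⟩,
    fun T hT => ?_⟩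
  · simp only [hrel.2 u v huv]
    cases coinRel ω v u <;> simp
  have hlen := length_inorder_of_spanning hT
  have hadd := numShortcuts_add hT
  have hA : (fun x y => decide ((⟨fun i j => coinRel ω i j = true⟩ : Digraph (Fin n)).Adj x y)) =
      coinRel ω := by
    funext x y
    simp
  have hmain := fwdCount_shortcutTree_le (G := ⟨fun i j => coinRel ω i j = true⟩) hrel
    (fun x y => Iff.rfl) (K := 2 * ℓ) (L := ℓ) (w := 2 * ℓ + 3) (by positivity) (by positivity)
    (fun p hp hpn => by exact_mod_cast h₁ p hp hpn) h₂ T hT.2.2 [] (by simp) (by simp) hT.1 (by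
      ext u
      simp [pathSet, hT.2.1 u])
  have hfw : fwdCount (coinRel ω) T.inorder =
      (⟨fun i j => coinRel ω i j = true⟩ : Digraph (Fin n)).numShortcuts T + (n - 1) := by
    rw [hadd]
    congr 1
    funext x y
    simp
  rw [hfw, hlen] at hmain
  rw [Nat.cast_choose_two]
  simp only [List.length_nil, Nat.sub_zero] at hmain
  push_cast [Nat.cast_sub (show 1 ≤ n by omega)] at hmain
  have hn0 : (16 : ℝ) ≤ n := by exact_mod_cast hn
  set x := Real.logb 2 n
  have hℓ0 : (0 : ℝ) ≤ ℓ := Nat.cast_nonneg _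
  -- With ℓ ≤ x + 1 the left side is at most 8x² + 22x + 17. Dividing 16x² by 4 gives the constant 4
  -- of the theorem.
  have hq : 2 * (ℓ : ℝ) * (4 * ℓ + 2) + (2 * ℓ + 3) ≤ 16 * x ^ 2 := by nlinarith
  have := mul_le_mul_of_nonneg_right hq (show (0 : ℝ) ≤ n by linarith)
  nlinarith

end UpperBound

/-! ### Reasoning about programs -/

namespace WordRAM

/-- Run the programs of a list one after the other. -/
def block : List Program → Program
  | [] => .skip
  | p :: l => .seq p (block l)

/-- Started in `s`, the program `p` halts within `c` steps in a state with the property `Q`. -/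
def WP (W : ℕ) (p : Program) (c : ℕ) (Q : State → Prop) (s : State) : Prop :=
  ∃ t s', t ≤ c ∧ Exec W p s t s' ∧ Q s'

/-- Does the program `p` contain an instruction that writes the register `x`? -/
def Program.writesReg : Program → ℕ → Bool
  | .skip, _ => false
  | .const y _, x => x == y
  | .move y _, x => x == y
  | .add y _ _, x => x == y
  | .sub y _ _, x => x == y
  | .mul y _ _, x => x == y
  | .load y _, x => x == y
  | .store _ _, _ => false
  | .seq p q, x => p.writesReg x || q.writesReg x
  | .ifLt _ _ p q, x => p.writesReg x || q.writesReg x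
  | .whileLt _ _ p, x => p.writesReg x

/-- The registers that `p` does not write have the same contents in `s` and in `s'`. -/
def Frame (p : Program) (s s' : State) : Prop :=
  ∀ x, p.writesReg x = false → s'.reg x = s.reg x

@[simp] theorem State.reg_setReg (s : State) (x v y : ℕ) :
    (s.setReg x v).reg y = if y = x then v else s.reg y := by
  simp [State.setReg, Function.update_apply]

@[simp] theorem State.mem_setReg (s : State) (x v : ℕ) : (s.setReg x v).mem = s.mem := rfl

@[simp] theorem State.reg_setMem (s : State) (a v : ℕ) : (s.setMem a v).reg = s.reg := rfl

@[simp] theorem State.mem_setMem (s : State) (a v b : ℕ) :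
    (s.setMem a v).mem b = if b = a then v else s.mem b := by
  simp [State.setMem, Function.update_apply]

theorem Exec.frame {W : ℕ} {p : Program} {s s' : State} {t : ℕ} (h : Exec W p s t s') :
    Frame p s s' := by
  induction h with
  | seq _ _ ih₁ ih₂ =>
    intro x hx
    simp only [Program.writesReg, Bool.or_eq_false_iff] at hx
    rw [ih₂ x hx.2, ih₁ x hx.1]
  | ifLt_true _ _ ih =>
    intro x hx
    simp only [Program.writesReg, Bool.or_eq_false_iff] at hx
    exact ih x hx.1
  | ifLt_false _ _ ih =>
    intro x hx
    simp only [Program.writesReg, Bool.or_eq_false_iff] at hx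
    exact ih x hx.2
  | whileLt_true _ _ _ ih₁ ih₂ =>
    intro x hx
    rw [ih₂ x hx, ih₁ x hx]
  | _ =>
    intro x hx
    simp_all [Program.writesReg]

variable {W : ℕ} {s : State} {Q : State → Prop}

theorem WP.mono {p : Program} {c c' : ℕ} {Q' : State → Prop} (h : WP W p c Q s) (hc : c ≤ c')
    (hQ : ∀ s', Q s' → Q' s') : WP W p c' Q' s := by
  obtain ⟨t, s', ht, he, hq⟩ := h
  exact ⟨t, s', ht.trans hc, he, hQ _ hq⟩

theorem WP.frame {p : Program} {c : ℕ} (h : WP W p c Q s) :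
    WP W p c (fun s' => Frame p s s' ∧ Q s') s := by
  obtain ⟨t, s', ht, he, hq⟩ := h
  exact ⟨t, s', ht, he, he.frame, hq⟩

theorem wp_nil (h : Q s) : WP W (block []) 1 Q s := ⟨1, s, le_rfl, .skip s, h⟩

theorem wp_cons {p : Program} {l : List Program} {c₁ c₂ : ℕ}
    (h : WP W p c₁ (fun s₁ => WP W (block l) c₂ Q s₁) s) : WP W (block (p :: l)) (c₁ + c₂) Q s := by
  obtain ⟨t₁, s₁, h₁, e₁, t₂, s₂, h₂, e₂, hq⟩ := h
  exact ⟨t₁ + t₂, s₂, by omega, .seq e₁ e₂, hq⟩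

theorem wp_instr {p : Program} {l : List Program} {c : ℕ}
    (h : WP W p 1 (fun s₁ => WP W (block l) c Q s₁) s) : WP W (block (p :: l)) (c + 1) Q s :=
  (wp_cons h).mono (by omega) fun _ h => h

/-- Run `p` with the postcondition `R`, then the rest. -/
theorem wp_cons' {p : Program} {l : List Program} {c₁ c₂ : ℕ} {R : State → Prop}
    (h : WP W p c₁ R s) (h' : ∀ s₁, Frame p s s₁ → R s₁ → WP W (block l) c₂ Q s₁) :
    WP W (block (p :: l)) (c₁ + c₂) Q s :=
  wp_cons (h.frame.mono le_rfl fun s₁ hs => h' s₁ hs.1 hs.2)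

theorem wp_const {l : List Program} {c x k : ℕ} (hk : k < W)
    (h : WP W (block l) c Q (s.setReg x k)) : WP W (block (.const x k :: l)) (c + 1) Q s :=
  wp_instr ⟨1, _, le_rfl, .const s x k hk, h⟩

theorem wp_move {l : List Program} {c x y : ℕ} (v : ℕ) (hv : s.reg y = v) (hW : v < W)
    (h : WP W (block l) c Q (s.setReg x v)) : WP W (block (.move x y :: l)) (c + 1) Q s := by
  subst hv
  exact wp_instr ⟨1, _, le_rfl, .move s x y hW, h⟩

theorem wp_add {l : List Program} {c x y z : ℕ} (v : ℕ) (hv : s.reg y + s.reg z = v) (hW : v < W)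
    (h : WP W (block l) c Q (s.setReg x v)) : WP W (block (.add x y z :: l)) (c + 1) Q s := by
  subst hv
  exact wp_instr ⟨1, _, le_rfl, .add s x y z hW, h⟩

theorem wp_sub {l : List Program} {c x y z : ℕ} (v : ℕ) (hv : s.reg y - s.reg z = v) (hW : v < W)
    (h : WP W (block l) c Q (s.setReg x v)) : WP W (block (.sub x y z :: l)) (c + 1) Q s := by
  subst hv
  exact wp_instr ⟨1, _, le_rfl, .sub s x y z hW, h⟩

theorem wp_mul {l : List Program} {c x y z : ℕ} (v : ℕ) (hv : s.reg y * s.reg z = v) (hW : v < W)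
    (h : WP W (block l) c Q (s.setReg x v)) : WP W (block (.mul x y z :: l)) (c + 1) Q s := by
  subst hv
  exact wp_instr ⟨1, _, le_rfl, .mul s x y z hW, h⟩

theorem wp_load {l : List Program} {c x y : ℕ} (a v : ℕ) (ha : s.reg y = a) (hv : s.mem a = v)
    (haW : a < W) (hW : v < W) (h : WP W (block l) c Q (s.setReg x v)) :
    WP W (block (.load x y :: l)) (c + 1) Q s := by
  subst ha hv
  exact wp_instr ⟨1, _, le_rfl, .load s x y haW hW, h⟩

theorem wp_store {l : List Program} {c x y : ℕ} (a v : ℕ) (ha : s.reg x = a) (hv : s.reg y = v)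
    (haW : a < W) (hW : v < W) (h : WP W (block l) c Q (s.setMem a v)) :
    WP W (block (.store x y :: l)) (c + 1) Q s := by
  subst ha hv
  exact wp_instr ⟨1, _, le_rfl, .store s x y haW hW, h⟩

theorem wp_ifLt {p q : Program} {c x y : ℕ} (h₁ : s.reg x < s.reg y → WP W p c Q s)
    (h₂ : ¬ s.reg x < s.reg y → WP W q c Q s) : WP W (.ifLt x y p q) (c + 1) Q s := by
  by_cases h : s.reg x < s.reg y
  · obtain ⟨t, s', ht, he, hq⟩ := h₁ h
    exact ⟨1 + t, s', by omega, .ifLt_true h he, hq⟩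
  · obtain ⟨t, s', ht, he, hq⟩ := h₂ h
    exact ⟨1 + t, s', by omega, .ifLt_false h he, hq⟩

theorem wp_while_step {p : Program} {x y c c' : ℕ} (h : s.reg x < s.reg y)
    (hp : WP W p c (fun s₁ => WP W (.whileLt x y p) c' Q s₁) s) :
    WP W (.whileLt x y p) (c + c' + 1) Q s := by
  obtain ⟨t₁, s₁, h₁, e₁, t₂, s₂, h₂, e₂, hq⟩ := hp
  exact ⟨1 + t₁ + t₂, s₂, by omega, .whileLt_true h e₁ e₂, hq⟩

theorem wp_while_done {p : Program} {x y : ℕ} (h : ¬ s.reg x < s.reg y) (hq : Q s) :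
    WP W (.whileLt x y p) 1 Q s :=
  ⟨1, s, le_rfl, .whileLt_false h, hq⟩

theorem Frame.refl (p : Program) (s : State) : Frame p s s := fun _ _ => rfl

theorem Frame.trans {p : Program} {s₁ s₂ s₃ : State} (h : Frame p s₁ s₂) (h' : Frame p s₂ s₃) :
    Frame p s₁ s₃ := fun x hx => (h' x hx).trans (h x hx)

/-- A loop whose counter `x` runs from `0` to the contents `m` of the register `y`. -/
theorem wp_for {p : Program} {x y m c : ℕ} (I : ℕ → State → Prop) (hx : s.reg x = 0)
    (hy : s.reg y = m) (hp : p.writesReg y = false) (h₀ : I 0 s)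
    (step : ∀ i < m, ∀ s', s'.reg x = i → Frame p s s' → I i s' →
      WP W p c (fun s'' => s''.reg x = i + 1 ∧ I (i + 1) s'') s') :
    WP W (.whileLt x y p) (m * (c + 1) + 1) (I m) s := by
  have key : ∀ k i s', i + k = m → s'.reg x = i → Frame p s s' → I i s' →
      WP W (.whileLt x y p) (k * (c + 1) + 1) (I m) s' := by
    intro k
    induction k with
    | zero =>
      intro i s' hi hxi hf hI
      have := hf y hp
      rw [zero_mul]
      refine wp_while_done (by omega) ?_
      rw [add_zero] at hi
      exact hi ▸ hI
    | succ k ih =>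
      intro i s' hi hxi hf hI
      have hy' := hf y hp
      refine (wp_while_step (by omega) ((step i (by omega) s' hxi hf hI).frame.mono le_rfl
        fun s'' hs => ih (i + 1) s'' (by omega) hs.2.1 (hf.trans hs.1) hs.2.2)).mono ?_
          fun _ h => h
      ring_nf
      omega
  exact key m 0 s (by omega) hx (Frame.refl _ _) h₀

/-- The memory holds the list `l` at the address `a`. -/
def Stored (mem : ℕ → ℕ) (a : ℕ) (l : List ℕ) : Prop :=
  ∀ (j : ℕ) (h : j < l.length), mem (a + j) = l[j]

theorem Stored.congr {mem mem' : ℕ → ℕ} {a : ℕ} {l : List ℕ} (h : Stored mem a l)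
    (h' : ∀ b, a ≤ b → b < a + l.length → mem' b = mem b) : Stored mem' a l := by
  intro j hj
  rw [h' _ (by omega) (by omega), h j hj]

theorem stored_nil (mem : ℕ → ℕ) (a : ℕ) : Stored mem a [] := by
  intro j hj
  simp at hj

theorem Stored.append_singleton {mem : ℕ → ℕ} {a : ℕ} {l : List ℕ} {v : ℕ} (h : Stored mem a l)
    (hv : mem (a + l.length) = v) : Stored mem a (l ++ [v]) := by
  intro j hj
  rw [List.length_append, List.length_singleton] at hj
  rcases Nat.lt_or_ge j l.length with hj' | hj'
  · rw [h j hj', List.getElem_append_left hj']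
  · obtain rfl : j = l.length := by omega
    simpa using hv

end WordRAM

/-! ### The loops of the algorithm

The registers: `0` holds `n`, `1` holds `1`, `2` holds `n * n`, `3` points to the first pending
block, `4` to the free memory, `5` holds `0`, `6` is the slot of the current block, `7` its length,
`8` the address of its list. -/

namespace WordRAM

variable {n : ℕ}

/-- Write the elements `y` of the current list with a `1` at the address `y * r₁₃ + r₁₄` to the
address in the register `19`; their number goes to the register `20`. -/
def filterBody : Program := block [
  .add 11 8 10, .load 12 11, .add 11 19 20, .store 11 12, .mul 12 12 13, .add 12 12 14,
  .load 12 12, .add 20 20 12, .add 10 10 1]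

/-- The loop of `filterBody`. -/
def filterLoop : Program := block [.const 20 0, .const 10 0, .whileLt 10 7 filterBody]

theorem filterLoop_spec {W : ℕ} {s : State} (xs : List (Fin n)) (P : Fin n → Bool) (st α β o : ℕ)
    (h1 : s.reg 1 = 1) (h7 : s.reg 7 = xs.length) (h8 : s.reg 8 = st) (h13 : s.reg 13 = α)
    (h14 : s.reg 14 = β) (h19 : s.reg 19 = o) (hst : st + xs.length ≤ o) (hn : n * n ≤ o)
    (hoW : o + xs.length < W) (hnW : n < W) (hxs : Stored s.mem st (xs.map Fin.val))
    (hP : ∀ y ∈ xs, y.val * α + β < n * n ∧ s.mem (y.val * α + β) = if P y then 1 else 0) :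
    WP W filterLoop (xs.length * 11 + 4)
      (fun s' => s'.reg 20 = (xs.filter P).length ∧
        Stored s'.mem o ((xs.filter P).map Fin.val) ∧ ∀ a < o, s'.mem a = s.mem a) s := by
  refine wp_const (by omega) (wp_const (by omega) (wp_cons (c₂ := 1) ((wp_for (m := xs.length)
    (c := 10) (fun i s' => s'.reg 20 = ((xs.take i).filter P).length ∧
        Stored s'.mem o (((xs.take i).filter P).map Fin.val) ∧ ∀ a < o, s'.mem a = s.mem a)
    ?_ ?_ rfl ?_ ?_).mono le_rfl ?_)))
  · simp
  · simp [h7]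
  · simp [stored_nil]
  · rintro i hi s' h10 hf ⟨hk, hS, hm⟩
    have f1 := hf 1 rfl
    have f8 := hf 8 rfl
    have f13 := hf 13 rfl
    have f14 := hf 14 rfl
    have f19 := hf 19 rfl
    simp [h1, h8, h13, h14, h19] at f1 f8 f13 f14 f19
    have hkl : ((xs.take i).filter P).length ≤ i :=
      (List.length_filter_le _ _).trans (List.length_take_le _ _)
    set k := ((xs.take i).filter P).length with hkdef
    set y := xs[i] with hy
    obtain ⟨hyα, hyP⟩ := hP y (List.getElem_mem _)
    have hyn := y.isLt
    have hye : s'.mem (st + i) = y.val := by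
      rw [hm _ (by omega), hxs i (by simpa using hi)]
      simp [hy]
    refine wp_add (st + i) (by rw [f8, h10]) (by omega) ?_
    refine wp_load (st + i) y (by simp) (by simp [hye]) (by omega) (by omega) ?_
    refine wp_add (o + k) (by simp [f19, hk]) (by omega) ?_
    -- The write is unconditional; only the counter depends on the matrix entry, so a rejected
    -- element is overwritten later or lies behind the end of the list.
    refine wp_store (o + k) y (by simp) (by simp) (by omega) (by omega) ?_
    refine wp_mul (y * α) (by simp [f13]) (by omega) ?_
    refine wp_add (y * α + β) (by simp [f14]) (by omega) ?_
    have hne : y.val * α + β ≠ o + k := by omega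
    refine wp_load (y * α + β) (if P y then 1 else 0) (by simp)
      (by simp [hne, hm _ (show y.val * α + β < o by omega), hyP]) (by omega)
      (by split_ifs <;> omega) ?_
    refine wp_add (k + if P y then 1 else 0) (by simp [hk]) (by split_ifs <;> omega) ?_
    refine wp_add (i + 1) (by simp [h10, f1]) (by omega) ?_
    refine wp_nil ⟨by simp, ?_⟩
    have ht : (xs.take (i + 1)).filter P = (xs.take i).filter P ++ if P y then [y] else [] := by
      rw [List.take_succ_eq_append_getElem hi, List.filter_append]
      congr 1
      by_cases hp : P y <;> simp [hp, ← hy]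
    have hS' : Stored (s'.setMem (o + k) y).mem o (((xs.take i).filter P).map Fin.val) := by
      refine hS.congr fun b hb hb' => ?_
      rw [List.length_map, ← hkdef] at hb'
      simp [show b ≠ o + k by omega]
    have hm' : ∀ a < o, (s'.setMem (o + k) y).mem a = s.mem a := by
      intro a ha
      simp [show a ≠ o + k by omega, hm a ha]
    rw [ht]
    by_cases hp : P y
    · simp only [hp, if_true, List.length_append, List.length_singleton, List.map_append,
        List.map_cons, List.map_nil]
      refine ⟨by simp [hkdef], ?_, hm'⟩
      refine hS'.append_singleton ?_
      simp [hkdef]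
    · simp only [hp]
      refine ⟨by simp [hkdef], by
        simp only [Bool.false_eq_true, if_false, List.append_nil]
        exact hS', hm'⟩
  · intro s' h
    rw [List.take_length] at h
    exact wp_nil h

/-- One round of `degreeLoop`. -/
def degreeBody : Program := block [
  .add 11 8 9, .load 12 11, .mul 14 12 0, filterLoop, .add 11 4 9, .store 11 20, .add 9 9 1]

/-- Write the out-degrees of the vertices of the current list to the free memory. -/
def degreeLoop : Program := block [.const 9 0, .move 13 1, .whileLt 9 7 degreeBody]

/-- The input part of the memory. -/
def HasInput (A : Fin n → Fin n → Bool) (mem : ℕ → ℕ) : Prop :=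
  ∀ i j : Fin n, mem (i.val * n + j.val) = if A i j then 1 else 0

theorem cell_lt (i j : Fin n) : i.val * n + j.val < n * n := by
  have hi := i.isLt
  have hj := j.isLt
  calc i.val * n + j.val < i.val * n + n := by omega
    _ = (i.val + 1) * n := by ring
    _ ≤ n * n := Nat.mul_le_mul_right _ hi

theorem HasInput.congr {A : Fin n → Fin n → Bool} {mem mem' : ℕ → ℕ} (h : HasInput A mem)
    (h' : ∀ a < n * n, mem' a = mem a) : HasInput A mem' := fun i j => by
  rw [h' _ (cell_lt i j), h]

theorem degreeLoop_spec {W : ℕ} {s : State} (A : Fin n → Fin n → Bool) (xs : List (Fin n))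
    (st hp : ℕ) (h0 : s.reg 0 = n) (h1 : s.reg 1 = 1) (h4 : s.reg 4 = hp)
    (h7 : s.reg 7 = xs.length) (h8 : s.reg 8 = st) (h19 : s.reg 19 = hp + xs.length)
    (hst : st + xs.length ≤ hp) (hn : n * n ≤ hp) (hW : hp + 2 * xs.length < W) (hnW : n < W)
    (h1W : 1 < W) (hA : HasInput A s.mem) (hxs : Stored s.mem st (xs.map Fin.val)) :
    WP W degreeLoop (xs.length * (xs.length * 11 + 12) + 4)
      (fun s' => Stored s'.mem hp (xs.map fun x => xs.countP (A x)) ∧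
        ∀ a < hp, s'.mem a = s.mem a) s := by
  refine wp_const (by omega) (wp_move 1 (by simp [h1]) h1W (wp_cons (c₂ := 1) ((wp_for
    (m := xs.length) (c := xs.length * 11 + 11)
    (fun i s' => Stored s'.mem hp ((xs.take i).map fun x => xs.countP (A x)) ∧
        ∀ a < hp, s'.mem a = s.mem a)
    ?_ ?_ rfl ?_ ?_).mono le_rfl ?_)))
  · simp
  · simp [h7]
  · simp [stored_nil]
  · rintro i hi s' h9 hf ⟨hS, hm⟩
    have f0 := hf 0 rfl
    have f1 := hf 1 rfl
    have f4 := hf 4 rfl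
    have f7 := hf 7 rfl
    have f8 := hf 8 rfl
    have f13 := hf 13 rfl
    have f19 := hf 19 rfl
    simp [h0, h1, h4, h7, h8, h19] at f0 f1 f4 f7 f8 f13 f19
    set x := xs[i] with hx
    have hxn := x.isLt
    have hxe : s'.mem (st + i) = x.val := by
      rw [hm _ (by omega), hxs i (by simpa using hi)]
      simp [hx]
    have hxs' : Stored s'.mem st (xs.map Fin.val) := hxs.congr fun b _ hb => hm b (by
      rw [List.length_map] at hb
      omega)
    have hA' : HasInput A s'.mem := hA.congr fun a ha => hm a (by omega)
    refine wp_add (st + i) (by rw [f8, h9]) (by omega) ?_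
    refine wp_load (st + i) x (by simp) (by simp [hxe]) (by omega) (by omega) ?_
    have hxn2 : x.val * n ≤ n * n := Nat.mul_le_mul_right _ hxn.le
    refine wp_mul (x * n) (by simp [f0]) (by omega) ?_
    -- The filtered list goes to scratch cells behind the degree table and is discarded; only its
    -- length, the out-degree, is kept.
    refine wp_cons' (c₁ := xs.length * 11 + 4) (c₂ := 4) (filterLoop_spec xs (A x) st 1 (x * n)
      (hp + xs.length) (by simp [f1]) (by simp [f7])
      (by simp [f8]) (by simp [f13]) (by simp) (by simp [f19]) (by omega) (by omega) (by omega)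
      hnW (by simpa using hxs') ?_) ?_
    · intro y _
      rw [mul_one, add_comm]
      exact ⟨cell_lt x y, by simpa using hA' x y⟩
    · rintro s₁ g ⟨gk, -, gm⟩
      have g1 := g 1 rfl
      have g4 := g 4 rfl
      have g9 := g 9 rfl
      simp [f1, f4, h9] at g1 g4 g9
      have hk := List.length_filter_le (A x) xs
      refine wp_add (hp + i) (by rw [g4, g9]) (by omega) ?_
      refine wp_store (hp + i) (xs.filter (A x)).length (by simp) (by simp [gk]) (by omega)
        (by omega) ?_
      refine wp_add (i + 1) (by simp [g9, g1]) (by omega) ?_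
      refine wp_nil ⟨by simp, ?_, ?_⟩
      · rw [List.take_succ_eq_append_getElem hi, List.map_append]
        refine Stored.append_singleton ?_ ?_
        · refine hS.congr fun b hb hb' => ?_
          rw [List.length_map, List.length_take] at hb'
          simp [show b ≠ hp + i by omega]
          rw [gm b (by omega)]
          simp
        · have : min i xs.length = i := by omega
          simp [List.countP_eq_length_filter, this, hx]
      · intro a ha
        simp [show a ≠ hp + i by omega]
        rw [gm a (by omega)]
        simp [hm a ha]
  · intro s' h
    rw [List.take_length] at h
    exact wp_nil h

/-- Add the contribution of one vertex to the score in the register `15`. -/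
def scoreBody : Program := block [
  .add 11 8 10, .load 12 11, .add 12 14 12, .load 12 12, .add 11 4 10, .load 24 11, .add 24 23 24,
  .add 24 24 1, .add 24 24 1, .add 24 24 24, .mul 24 24 12, .add 15 15 24, .sub 12 1 12,
  .mul 12 12 22, .add 15 15 12, .add 10 10 1]

/-- Compute the score of a vertex. -/
def scoreLoop : Program := block [.const 15 0, .const 10 0, .whileLt 10 7 scoreBody]

theorem pivotScore_summand_le {V : Type*} (A : V → V → Bool) (hA : IsTournamentRel A) {xs : List V}
    (h : xs.Nodup) {v u : V} (hv : v ∈ xs) (hu : u ∈ xs) :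
    xs.countP (A v) + xs.countP (A u) + 2 ≤ 2 * xs.length := by
  have := countP_out_add_countP_in hA h hv
  have := countP_out_add_countP_in hA h hu
  omega

theorem sum_take_map_le {V : Type*} (f : V → ℕ) (c : ℕ) (xs : List V) (h : ∀ x ∈ xs, f x ≤ c)
    (i : ℕ) : ((xs.take i).map f).sum ≤ i * c := by
  have h1 : ((xs.take i).map f).sum ≤ ((xs.take i).map f).length * c := by
    refine (List.sum_le_card_nsmul _ _ fun y hy => ?_).trans_eq (smul_eq_mul _ _)
    obtain ⟨x, hx, rfl⟩ := List.mem_map.1 hy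
    exact h x (List.mem_of_mem_take hx)
  refine h1.trans (Nat.mul_le_mul_right _ ?_)
  rw [List.length_map]
  exact List.length_take_le _ _

theorem pivotScore_le {V : Type*} {A : V → V → Bool} (hA : IsTournamentRel A) {xs : List V}
    (h : xs.Nodup) {v : V} (hv : v ∈ xs) : pivotScore A xs v ≤ xs.length * (4 * xs.length) := by
  rw [pivotScore]
  have := sum_take_map_le (fun u => if A v u then 2 * (xs.countP (A v) + xs.countP (A u) + 2)
    else 3 * xs.length) (4 * xs.length) xs (fun u hu => by
      have := pivotScore_summand_le A hA h hv hu
      split_ifs <;> omega) xs.length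
  rwa [List.take_length] at this

theorem scoreLoop_spec {W : ℕ} {s : State} (A : Fin n → Fin n → Bool) (hA : IsTournamentRel A)
    (xs : List (Fin n)) (hnd : xs.Nodup) (v : Fin n) (hv : v ∈ xs)
    (st hp : ℕ) (h1 : s.reg 1 = 1) (h4 : s.reg 4 = hp)
    (h7 : s.reg 7 = xs.length) (h8 : s.reg 8 = st) (h14 : s.reg 14 = v * n)
    (h22 : s.reg 22 = 3 * xs.length) (h23 : s.reg 23 = xs.countP (A v))
    (hst : st + xs.length ≤ hp) (hW : hp + xs.length < W) (hn : n * n ≤ hp) (hnW : n < W)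
    (hmW : (xs.length + 1) * (4 * xs.length) + 1 < W)
    (hin : HasInput A s.mem) (hxs : Stored s.mem st (xs.map Fin.val))
    (hd : Stored s.mem hp (xs.map fun x => xs.countP (A x))) :
    WP W scoreLoop (xs.length * 18 + 4)
      (fun s' => s'.reg 15 = pivotScore A xs v ∧ s'.mem = s.mem) s := by
  set f : Fin n → ℕ := fun u => if A v u then 2 * (xs.countP (A v) + xs.countP (A u) + 2)
    else 3 * xs.length with hf
  have hfle : ∀ u ∈ xs, f u ≤ 4 * xs.length := by
    intro u hu
    have := pivotScore_summand_le A hA hnd hv hu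
    simp only [f]
    split_ifs <;> omega
  refine wp_const (by omega) (wp_const (by omega) (wp_cons (c₂ := 1) ((wp_for (m := xs.length)
    (c := 17) (fun i s' => s'.reg 15 = ((xs.take i).map f).sum ∧ s'.mem = s.mem)
    ?_ ?_ rfl ?_ ?_).mono le_rfl ?_)))
  · simp
  · simp [h7]
  · exact ⟨by simp, rfl⟩
  · rintro i hi s' h10 hf ⟨hk, hm⟩
    have f1 := hf 1 rfl
    have f4 := hf 4 rfl
    have f8 := hf 8 rfl
    have f14 := hf 14 rfl
    have f22 := hf 22 rfl
    have f23 := hf 23 rfl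
    simp [h1, h4, h8, h14, h22, h23] at f1 f4 f8 f14 f22 f23
    set u := xs[i] with hu
    have hux : u ∈ xs := List.getElem_mem _
    have hun := u.isLt
    have hue : s'.mem (st + i) = u.val := by
      rw [hm, hxs i (by simpa using hi)]
      simp [hu]
    have hde : s'.mem (hp + i) = xs.countP (A u) := by
      rw [hm, hd i (by simpa using hi)]
      simp [hu]
    have hce : s'.mem (v * n + u) = if A v u then 1 else 0 := by
      rw [hm, hin]
    have hcell := cell_lt v u
    have hdd := pivotScore_summand_le A hA hnd hv hux
    have hsum := sum_take_map_le f (4 * xs.length) xs hfle i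
    have hsum' : i * (4 * xs.length) ≤ xs.length * (4 * xs.length) :=
      Nat.mul_le_mul_right _ hi.le
    rw [add_mul, one_mul] at hmW
    set M := xs.length * (4 * xs.length) with hM
    set σ := ((xs.take i).map f).sum with hσ
    set dv := xs.countP (A v)
    set du := xs.countP (A u) with hdu
    set e : ℕ := if A v u then 1 else 0 with he
    have he1 : e ≤ 1 := by rw [he]; split_ifs <;> omega
    have hte : (dv + du + 2 + (dv + du + 2)) * e ≤ 4 * xs.length := by
      calc _ ≤ (dv + du + 2 + (dv + du + 2)) * 1 := Nat.mul_le_mul_left _ he1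
        _ ≤ _ := by omega
    have hte' : (1 - e) * (3 * xs.length) ≤ 4 * xs.length := by
      calc _ ≤ 1 * (3 * xs.length) := Nat.mul_le_mul_right _ (by omega)
        _ ≤ _ := by omega
    -- The matrix entry e ∈ {0, 1} selects the summand arithmetically, so the body needs no branch.
    have hfu : f u = (dv + du + 2 + (dv + du + 2)) * e + (1 - e) * (3 * xs.length) := by
      simp only [f, he]
      split_ifs
      · simp only [dv, du]
        omega
      · omega
    have hfu' := hfle u hux
    refine wp_add (st + i) (by rw [f8, h10]) (by omega) ?_
    refine wp_load (st + i) u (by simp) (by simp [hue]) (by omega) (by omega) ?_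
    refine wp_add (v * n + u) (by simp [f14]) (by omega) ?_
    refine wp_load (v * n + u) e (by simp) (by simp [hce]) (by omega) (by omega) ?_
    refine wp_add (hp + i) (by simp [f4, h10]) (by omega) ?_
    refine wp_load (hp + i) du (by simp) (by simp [hde]) (by omega) (by omega) ?_
    refine wp_add (dv + du) (by simp [f23]) (by omega) ?_
    refine wp_add (dv + du + 1) (by simp [f1]) (by omega) ?_
    refine wp_add (dv + du + 2) (by simp [f1]) (by omega) ?_
    refine wp_add (dv + du + 2 + (dv + du + 2)) (by simp) (by omega) ?_
    refine wp_mul ((dv + du + 2 + (dv + du + 2)) * e) (by simp) (by omega) ?_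
    refine wp_add (σ + (dv + du + 2 + (dv + du + 2)) * e) (by simp [hk]) (by omega) ?_
    refine wp_sub (1 - e) (by simp [f1]) (by omega) ?_
    refine wp_mul ((1 - e) * (3 * xs.length)) (by simp [f22]) (by omega) ?_
    refine wp_add (σ + f u) (by simp [hfu, add_assoc]) (by omega) ?_
    refine wp_add (i + 1) (by simp [h10, f1]) (by omega) ?_
    refine wp_nil ⟨by simp, ?_, by simpa using hm⟩
    rw [List.take_succ_eq_append_getElem hi, List.map_append, List.sum_append]
    simp [hσ, hu]
  · intro s' h
    rw [List.take_length] at h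
    exact wp_nil h

/-- Compare the score of one vertex with the best score so far. -/
def pivotBody : Program := block [
  .add 11 8 9, .load 25 11, .mul 14 25 0, .add 11 4 9, .load 23 11, scoreLoop,
  .ifLt 15 17 (block [.move 17 15, .move 18 25]) (block []), .add 9 9 1]

/-- Find a vertex of the smallest score. -/
def pivotLoop : Program := block [.const 9 0, .const 17 5, .mul 17 17 2, .whileLt 9 7 pivotBody]

theorem pivotLoop_spec {W : ℕ} {s : State} (A : Fin n → Fin n → Bool) (hA : IsTournamentRel A)
    (xs : List (Fin n)) (hnd : xs.Nodup) (hne : xs ≠ [])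
    (st hp : ℕ) (h0 : s.reg 0 = n) (h1 : s.reg 1 = 1) (h2 : s.reg 2 = n * n) (h4 : s.reg 4 = hp)
    (h7 : s.reg 7 = xs.length) (h8 : s.reg 8 = st) (h22 : s.reg 22 = 3 * xs.length)
    (hst : st + xs.length ≤ hp) (hW : hp + xs.length < W) (hn : n * n ≤ hp) (hnW : n < W)
    (hmW : 8 * (n * n) + 8 < W)
    (hin : HasInput A s.mem) (hxs : Stored s.mem st (xs.map Fin.val))
    (hd : Stored s.mem hp (xs.map fun x => xs.countP (A x))) :
    WP W pivotLoop (xs.length * (xs.length * 18 + 16) + 5)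
      (fun s' => (∃ v ∈ xs, (∀ u ∈ xs, pivotScore A xs v ≤ pivotScore A xs u) ∧
        s'.reg 18 = v.val) ∧ s'.mem = s.mem) s := by
  have hlen : xs.length ≤ n := by simpa using hnd.length_le_card
  have hn1 : 1 ≤ n := (List.length_pos_iff.2 hne).trans_le hlen
  have hlen2 : xs.length * (4 * xs.length) ≤ 4 * (n * n) := by nlinarith
  have hnn : n ≤ n * n := Nat.le_mul_self n
  have hmW' : (xs.length + 1) * (4 * xs.length) + 1 < W := by
    rw [add_mul, one_mul]
    omega
  -- The initial value 5n² is a sentinel above every possible score, as scores are at most 4m². A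
  -- nonempty list therefore replaces it.
  refine wp_const (by omega) (wp_const (by omega) (wp_mul (5 * (n * n)) (by simp [h2]) (by omega)
    (wp_cons (c₂ := 1) ((wp_for (m := xs.length)
    (c := xs.length * 18 + 15) (fun i s' => (∀ u ∈ xs.take i, s'.reg 17 ≤ pivotScore A xs u) ∧
      (s'.reg 17 = 5 * (n * n) ∨ ∃ v ∈ xs, s'.reg 17 = pivotScore A xs v ∧ s'.reg 18 = v.val) ∧
        s'.mem = s.mem)
    ?_ ?_ rfl ?_ ?_).mono le_rfl ?_))))
  · simp
  · simp [h7]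
  · simp
  · rintro i hi s' h9 hf ⟨hmin, hbest, hm⟩
    have f0 := hf 0 rfl
    have f1 := hf 1 rfl
    have f4 := hf 4 rfl
    have f7 := hf 7 rfl
    have f8 := hf 8 rfl
    have f22 := hf 22 rfl
    simp [h0, h1, h4, h7, h8, h22] at f0 f1 f4 f7 f8 f22
    set x := xs[i] with hx
    have hxx : x ∈ xs := List.getElem_mem _
    have hxn := x.isLt
    have hxe : s'.mem (st + i) = x.val := by
      rw [hm, hxs i (by simpa using hi)]
      simp [hx]
    have hde : s'.mem (hp + i) = xs.countP (A x) := by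
      rw [hm, hd i (by simpa using hi)]
      simp [hx]
    have hxn2 : x.val * n ≤ n * n := Nat.mul_le_mul_right _ hxn.le
    have hdle : xs.countP (A x) ≤ xs.length := List.countP_le_length
    have hsc := pivotScore_le hA hnd hxx
    refine wp_add (st + i) (by rw [f8, h9]) (by omega) ?_
    refine wp_load (st + i) x (by simp) (by simp [hxe]) (by omega) (by omega) ?_
    refine wp_mul (x * n) (by simp [f0]) (by omega) ?_
    refine wp_add (hp + i) (by simp [f4, h9]) (by omega) ?_
    refine wp_load (hp + i) (xs.countP (A x)) (by simp) (by simp [hde]) (by omega) (by omega) ?_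
    refine wp_cons' (c₁ := xs.length * 18 + 4) (c₂ := 6) (scoreLoop_spec A hA xs hnd x hxx st hp
      (by simp [f1]) (by simp [f4]) (by simp [f7]) (by simp [f8]) (by simp) (by simp [f22])
      (by simp) hst hW hn hnW hmW' (by simpa [hm] using hin) (by simpa [hm] using hxs)
      (by simpa [hm] using hd)) ?_
    rintro s₁ g ⟨gs, gm⟩
    have g1 := g 1 rfl
    have g9 := g 9 rfl
    have g17 := g 17 rfl
    have g18 := g 18 rfl
    have g25 := g 25 rfl
    simp [f1, h9] at g1 g9 g17 g18 g25
    simp [hm] at gm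
    have hgood : WP W (.ifLt 15 17 (block [.move 17 15, .move 18 25]) (block [])) 4
        (fun s₂ => s₂.reg 1 = 1 ∧ s₂.reg 9 = i ∧
          (∀ u ∈ xs.take (i + 1), s₂.reg 17 ≤ pivotScore A xs u) ∧
          (s₂.reg 17 = 5 * (n * n) ∨
            ∃ v ∈ xs, s₂.reg 17 = pivotScore A xs v ∧ s₂.reg 18 = v.val) ∧
          s₂.mem = s.mem) s₁ := by
      rw [List.take_succ_eq_append_getElem hi]
      simp only [List.mem_append, List.mem_singleton]
      refine wp_ifLt (fun hlt => ?_) (fun hlt => ?_)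
      · refine wp_move (pivotScore A xs x) gs (by omega) (wp_move x (by simp [g25]) (by omega)
          (wp_nil ⟨by simp [g1], by simp [g9], ?_, Or.inr ⟨x, hxx, by simp, by simp⟩,
            by simpa using gm⟩))
        rintro u (hu | rfl)
        · have := hmin u hu
          simp
          omega
        · simp [hx]
      · refine (wp_nil ⟨by simp [g1], by simp [g9], ?_, by rw [g17, g18]; exact hbest,
            by simpa using gm⟩).mono (by norm_num) fun _ h => h
        rintro u (hu | rfl)
        · rw [g17]
          exact hmin u hu
        · rw [← hx]
          omega
    refine wp_cons (c₂ := 2) (hgood.mono le_rfl ?_)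
    rintro s₂ ⟨k1, k9, kmin, kbest, km⟩
    refine wp_add (i + 1) (by rw [k9, k1]) (by omega) (wp_nil ⟨by simp, ?_⟩)
    exact ⟨by simpa using kmin, by simpa using kbest, by simpa using km⟩
  · rintro s' ⟨hmin, hbest, hm⟩
    rw [List.take_length] at hmin
    refine wp_nil ⟨?_, hm⟩
    rcases hbest with hb | ⟨v, hv, hb, h18⟩
    · obtain ⟨u, hu⟩ := List.exists_mem_of_ne_nil xs hne
      have h3 := hmin u hu
      have h4 := pivotScore_le hA hnd hu
      have h5 : 1 ≤ n * n := by nlinarith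
      omega
    · exact ⟨v, hv, fun u hu => hb ▸ hmin u hu, h18⟩

end WordRAM

/-! ### The algorithm -/

namespace WordRAM

variable {n : ℕ}

/-- The memory holds a block at the address `p`: a pointer to the next block, the slot for the
result, and a list with its length. -/
structure BlockAt (mem : ℕ → ℕ) (p next slot : ℕ) (xs : List (Fin n)) : Prop where
  next_eq : mem p = next
  slot_eq : mem (p + 1) = slot
  length_eq : mem (p + 2) = xs.length
  stored : Stored mem (p + 3) (xs.map Fin.val)

theorem BlockAt.congr {mem mem' : ℕ → ℕ} {p next slot : ℕ} {xs : List (Fin n)}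
    (h : BlockAt mem p next slot xs)
    (h' : ∀ a, p ≤ a → a < p + 3 + xs.length → mem' a = mem a) : BlockAt mem' p next slot xs := by
  refine ⟨?_, ?_, ?_, h.stored.congr fun b hb hb' => ?_⟩
  · rw [h' _ (by omega) (by omega), h.next_eq]
  · rw [h' _ (by omega) (by omega), h.slot_eq]
  · rw [h' _ (by omega) (by omega), h.length_eq]
  · rw [List.length_map] at hb'
    exact h' b (by omega) (by omega)

/-- Allocate a block with the output of `filterLoop`. -/
def makeBlock : Program := block [
  .const 11 3, .add 19 4 11, filterLoop, .store 4 3, .add 11 4 1, .store 11 6, .add 11 11 1,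
  .store 11 20, .move 3 4, .add 4 19 20]

theorem makeBlock_spec {W : ℕ} {s : State} (xs : List (Fin n)) (P : Fin n → Bool)
    (st hp α β next slot : ℕ)
    (h1 : s.reg 1 = 1) (h3 : s.reg 3 = next) (h4 : s.reg 4 = hp) (h6 : s.reg 6 = slot)
    (h7 : s.reg 7 = xs.length) (h8 : s.reg 8 = st) (h13 : s.reg 13 = α) (h14 : s.reg 14 = β)
    (hst : st + xs.length ≤ hp) (hn : n * n ≤ hp)
    (hpW : hp + 3 + xs.length < W) (hnW : n < W) (hnext : next < W) (hslot : slot < W)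
    (hxs : Stored s.mem st (xs.map Fin.val))
    (hP : ∀ y ∈ xs, y.val * α + β < n * n ∧ s.mem (y.val * α + β) = if P y then 1 else 0) :
    WP W makeBlock (xs.length * 11 + 14) (fun s' => BlockAt s'.mem hp next slot (xs.filter P) ∧
      s'.reg 3 = hp ∧ s'.reg 4 = hp + 3 + (xs.filter P).length ∧ ∀ a < hp, s'.mem a = s.mem a)
      s := by
  refine wp_const (by omega) (wp_add (hp + 3) (by simp [h4]) (by omega) ?_)
  refine wp_cons' (c₁ := xs.length * 11 + 4) (c₂ := 8) (filterLoop_spec xs P st α β (hp + 3)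
    (by simp [h1]) (by simp [h7]) (by simp [h8]) (by simp [h13]) (by simp [h14]) (by simp)
    (by omega) (by omega) (by omega) hnW (by simpa using hxs) (by simpa using hP)) ?_
  rintro s₁ f ⟨hk, hS, hm⟩
  have f1 := f 1 rfl
  have f3 := f 3 rfl
  have f4 := f 4 rfl
  have f6 := f 6 rfl
  have f19 := f 19 rfl
  simp [h1, h3, h4, h6] at f1 f3 f4 f6 f19
  have hkl := List.length_filter_le P xs
  set k := (xs.filter P).length with hkd
  refine wp_store hp next f4 f3 (by omega) (by omega) ?_
  refine wp_add (hp + 1) (by simp [f1, f4]) (by omega) ?_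
  refine wp_store (hp + 1) slot (by simp) (by simp [f6]) (by omega) (by omega) ?_
  refine wp_add (hp + 2) (by simp [f1]) (by omega) ?_
  refine wp_store (hp + 2) k (by simp) (by simp [hk]) (by omega) (by omega) ?_
  refine wp_move hp (by simp [f4]) (by omega) ?_
  refine wp_add (hp + 3 + k) (by simp [f19, hk]) (by omega) ?_
  refine wp_nil ⟨⟨by simp, by simp, by simp [hkd], hS.congr fun b hb _ => ?_⟩, by simp, by simp,
    fun a ha => ?_⟩
  · simp [show b ≠ hp by omega, show b ≠ hp + 1 by omega, show b ≠ hp + 2 by omega]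
  · simp [show a ≠ hp by omega, show a ≠ hp + 1 by omega, show a ≠ hp + 2 by omega]
    rw [hm a (by omega)]
    simp

/-- The invariant of the main loop. -/
structure Good (A : Fin n → Fin n → Bool) (s : State) : Prop where
  reg_zero : s.reg 0 = n
  reg_one : s.reg 1 = 1
  reg_two : s.reg 2 = n * n
  reg_five : s.reg 5 = 0
  input : HasInput A s.mem
  free : n * n + 2 * n < s.reg 4

/-- Choose a pivot for the current list, and replace its block by two blocks. -/
def splitBlock : Program := block [
  .add 19 4 7, .add 22 7 7, .add 22 22 7, degreeLoop, pivotLoop, .add 11 18 1, .store 6 11,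
  .move 4 19, .add 6 2 18, .add 6 6 18, .add 6 6 1, .move 13 1, .mul 14 18 0, makeBlock,
  .sub 6 6 1, .move 13 0, .move 14 18, makeBlock]

/-- What `splitBlock` achieves between the states `s` and `s'`. -/
structure SplitPost (A : Fin n → Fin n → Bool) (xs : List (Fin n)) (next slot : ℕ) (s s' : State)
    (v : Fin n) (q₁ q₂ : ℕ) : Prop where
  mem_list : v ∈ xs
  min : ∀ u ∈ xs, pivotScore A xs v ≤ pivotScore A xs u
  slot_eq : s'.mem slot = v.val + 1
  right : BlockAt s'.mem q₁ next (n * n + 2 * v.val + 1) (xs.filter (A v))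
  left : BlockAt s'.mem q₂ q₁ (n * n + 2 * v.val) (xs.filter fun u => A u v)
  top : s'.reg 3 = q₂
  le_q₁ : s.reg 4 ≤ q₁
  le_q₂ : q₁ + 3 + (xs.filter (A v)).length ≤ q₂
  le_free : q₂ + 3 + (xs.filter fun u => A u v).length ≤ s'.reg 4
  free_le : s'.reg 4 ≤ s.reg 4 + (2 * xs.length + 5)
  unchanged : ∀ a < s.reg 4, a ≠ slot → s'.mem a = s.mem a
  good : Good A s'

-- The degree table occupies the first m free cells, and the two new blocks follow it, right block
-- below left. The old list is never overwritten, because the result slot lies before it and all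
-- other writes go to free memory.
set_option maxHeartbeats 600000 in
theorem splitBlock_spec {W : ℕ} {s : State} {A : Fin n → Fin n → Bool} (hA : IsTournamentRel A)
    (xs : List (Fin n)) (hnd : xs.Nodup) (hne : xs ≠ []) (st next slot : ℕ) (hs : Good A s)
    (h3 : s.reg 3 = next) (h6 : s.reg 6 = slot) (h7 : s.reg 7 = xs.length) (h8 : s.reg 8 = st)
    (hst : st + xs.length ≤ s.reg 4) (hslot : slot < st) (hslot' : n * n ≤ slot)
    (hW : s.reg 4 + 3 * xs.length + 6 < W) (hnW : 8 * (n * n) + 8 < W) (hnext : next < W)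
    (hxs : Stored s.mem st (xs.map Fin.val)) :
    WP W splitBlock (29 * xs.length ^ 2 + 50 * xs.length + 52)
      (fun s' => ∃ v q₁ q₂, SplitPost A xs next slot s s' v q₁ q₂) s := by
  obtain ⟨h0, h1, h2, h5, hin, hfree⟩ := hs
  set hp := s.reg 4 with h4
  set m := xs.length with hm
  have hmn : m ≤ n := by simpa using hnd.length_le_card
  have hn1 : 1 ≤ n := (List.length_pos_iff.2 hne).trans_le hmn
  have hnn : n ≤ n * n := Nat.le_mul_self n
  have hcost : 29 * m ^ 2 + 50 * m + 52 = (m * (m * 11 + 12) + 4) + ((m * (m * 18 + 16) + 5) +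
      ((m * 11 + 14) + ((m * 11 + 14) + 1 + 3) + 8)) + 3 := by ring
  rw [hcost]
  refine wp_add (hp + m) (by rw [h7]) (by omega) ?_
  refine wp_add (m + m) (by simp [h7]) (by omega) ?_
  refine wp_add (3 * m) (by simp [h7]; ring) (by omega) ?_
  refine wp_cons' (degreeLoop_spec A xs st hp (by simp [h0]) (by simp [h1]) (by simp [h4])
    (by simp [h7, hm]) (by simp [h8]) (by simp [hm]) hst (by omega) (by omega) (by omega) (by omega)
    (by simpa using hin) (by simpa using hxs)) ?_
  rintro s₁ f ⟨hd, hm₁⟩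
  have f0 := f 0 rfl
  have f1 := f 1 rfl
  have f2 := f 2 rfl
  have f3 := f 3 rfl
  have f4 := f 4 rfl
  have f5 := f 5 rfl
  have f6 := f 6 rfl
  have f7 := f 7 rfl
  have f8 := f 8 rfl
  have f19 := f 19 rfl
  have f22 := f 22 rfl
  simp [h0, h1, h2, h3, ← h4, h5, h6, h7, h8] at f0 f1 f2 f3 f4 f5 f6 f7 f8 f19 f22
  simp only [State.mem_setReg] at hm₁
  have hin₁ : HasInput A s₁.mem := hin.congr fun a ha => hm₁ a (by omega)
  have hxs₁ : Stored s₁.mem st (xs.map Fin.val) := hxs.congr fun b _ hb => hm₁ b (by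
    rw [List.length_map] at hb
    omega)
  refine wp_cons' (pivotLoop_spec A hA xs hnd hne st hp f0 f1 f2 f4 f7 f8 f22 hst (by omega)
    (by omega) (by omega) hnW hin₁ hxs₁ hd) ?_
  rintro s₂ g ⟨⟨v, hv, hmin, g18⟩, hm₂⟩
  have g0 := g 0 rfl
  have g1 := g 1 rfl
  have g2 := g 2 rfl
  have g3 := g 3 rfl
  have g4 := g 4 rfl
  have g5 := g 5 rfl
  have g6 := g 6 rfl
  have g7 := g 7 rfl
  have g8 := g 8 rfl
  have g19 := g 19 rfl
  rw [f0] at g0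
  rw [f1] at g1
  rw [f2] at g2
  rw [f3] at g3
  rw [f4] at g4
  rw [f5] at g5
  rw [f6] at g6
  rw [f7] at g7
  rw [f8] at g8
  rw [f19] at g19
  have hvn := v.isLt
  have hvn2 : v.val * n ≤ n * n := Nat.mul_le_mul_right _ hvn.le
  refine wp_add (v + 1) (by rw [g18, g1]) (by omega) ?_
  refine wp_store slot (v + 1) (by simp [g6]) (by simp) (by omega) (by omega) ?_
  refine wp_move (hp + m) (by simp [g19]) (by omega) ?_
  refine wp_add (n * n + v) (by simp [g2, g18]) (by omega) ?_
  refine wp_add (n * n + 2 * v) (by simp [g18]; ring) (by omega) ?_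
  refine wp_add (n * n + 2 * v + 1) (by simp [g1]) (by omega) ?_
  refine wp_move 1 (by simp [g1]) (by omega) ?_
  refine wp_mul (v * n) (by simp [g18, g0]) (by omega) ?_
  set s₃ := ((((((((s₂.setReg 11 (v + 1)).setMem slot (v + 1)).setReg 4 (hp + m)).setReg 6
    (n * n + v)).setReg 6 (n * n + 2 * v)).setReg 6 (n * n + 2 * v + 1)).setReg 13 1).setReg 14
    (v * n)) with hs₃
  have hm₃ : ∀ a < hp, a ≠ slot → s₃.mem a = s.mem a := by
    intro a ha has
    simp [hs₃, has, hm₂, hm₁ a ha]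
  have hslot₃ : s₃.mem slot = v + 1 := by simp [hs₃]
  have hin₃ : HasInput A s₃.mem := hin.congr fun a ha => hm₃ a (by omega) (by omega)
  have hxs₃ : Stored s₃.mem st (xs.map Fin.val) := hxs.congr fun b hb hb' => by
    rw [List.length_map] at hb'
    exact hm₃ b (by omega) (by omega)
  have hab := (perm_pivot hA hnd hv).length_eq
  rw [List.length_append, List.length_cons] at hab
  set R := xs.filter (A v) with hR
  set L := xs.filter fun u => A u v with hL
  refine wp_cons' (makeBlock_spec xs (A v) st (hp + m) 1 (v * n) next (n * n + 2 * v + 1)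
    (by simp [hs₃, g1]) (by simp [hs₃, g3]) (by simp [hs₃]) (by simp [hs₃]) (by simp [hs₃, g7, hm])
    (by simp [hs₃, g8]) (by simp [hs₃]) (by simp [hs₃]) (by omega) (by omega) (by omega)
    (by omega) hnext (by omega) hxs₃ ?_) ?_
  · intro y _
    rw [mul_one, add_comm]
    exact ⟨cell_lt v y, hin₃ v y⟩
  rintro s₄ k ⟨hB₄, k3, k4, hm₄⟩
  have k0 := k 0 rfl
  have k1 := k 1 rfl
  have k2 := k 2 rfl
  have k5 := k 5 rfl
  have k6 := k 6 rfl
  have k7 := k 7 rfl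
  have k8 := k 8 rfl
  have k18 := k 18 rfl
  simp [hs₃, g0, g1, g2, g5, g7, g8, g18] at k0 k1 k2 k5 k6 k7 k8 k18
  rw [← hR] at hB₄ k4
  have hin₄ : HasInput A s₄.mem := hin₃.congr fun a ha => hm₄ a (by omega)
  have hxs₄ : Stored s₄.mem st (xs.map Fin.val) := hxs₃.congr fun b hb hb' => by
    rw [List.length_map] at hb'
    exact hm₄ b (by omega)
  -- The left child's slot is the cell just before the right child's. Below, the factor `n` and
  -- offset `v` read a column of the matrix instead of a row.
  refine wp_sub (n * n + 2 * v) (by simp [k6, k1]) (by omega) ?_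
  refine wp_move n (by simp [k0]) (by omega) ?_
  refine wp_move v (by simp [k18]) (by omega) ?_
  refine wp_cons' (c₁ := m * 11 + 14) (c₂ := 1) (makeBlock_spec xs (fun u => A u v) st
    (hp + m + 3 + R.length) n v (hp + m) (n * n + 2 * v) (by simp [k1]) (by simp [k3]) (by simp [k4]) (by simp) (by simp [k7, hm])
    (by simp [k8]) (by simp) (by simp) (by omega) (by omega) (by omega)
    (by omega) (by omega) (by omega) (by simpa using hxs₄) ?_) ?_
  · intro y _
    exact ⟨cell_lt y v, by simpa using hin₄ y v⟩
  rintro s₅ l ⟨hB₅, l3, l4, hm₅⟩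
  have l0 := l 0 rfl
  have l1 := l 1 rfl
  have l2 := l 2 rfl
  have l5 := l 5 rfl
  simp [k0, k1, k2, k5] at l0 l1 l2 l5
  simp only [State.mem_setReg] at hm₅
  rw [← hL] at hB₅ l4
  refine wp_nil ⟨v, hp + m, hp + m + 3 + R.length, hv, hmin, ?_, hB₄.congr ?_, hB₅, l3, ?_, ?_, ?_,
    ?_, ?_, l0, l1, l2, l5, hin₄.congr ?_, ?_⟩
  · rw [hm₅ _ (by omega), hm₄ _ (by omega), hslot₃]
  · intro a _ ha
    exact hm₅ a ha
  · omega
  · exact le_rfl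
  · exact l4.ge
  · omega
  · intro a ha has
    rw [hm₅ _ (by omega), hm₄ _ (by omega), hm₃ _ (by omega) has]
  · intro a ha
    exact hm₅ a (by omega)
  · omega

/-- Process the first pending block. -/
def mainBody : Program := block [
  .add 11 3 1, .load 6 11, .add 11 11 1, .load 7 11, .add 8 11 1, .load 3 3,
  .ifLt 5 7 splitBlock (block [.store 6 5])]

/-- Process blocks while there are any. -/
def mainLoop : Program := .whileLt 5 3 mainBody

theorem Represents.congr {mem mem' : ℕ → ℕ} {b : ℕ} {T : BinaryTree (Fin n)} {p : ℕ}
    (h : Represents mem b T p) (h' : ∀ v ∈ T.inorder, mem' (b + 2 * v.val) = mem (b + 2 * v.val) ∧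
      mem' (b + 2 * v.val + 1) = mem (b + 2 * v.val + 1)) : Represents mem' b T p := by
  induction T generalizing p with
  | nil => exact h
  | node v l r ihl ihr =>
    obtain ⟨hp, hl, hr⟩ := h
    simp only [BinaryTree.inorder, List.mem_append, List.mem_cons] at h'
    obtain ⟨e1, e2⟩ := h' v (Or.inr (Or.inl rfl))
    refine ⟨hp, ?_, ?_⟩
    · rw [e1]
      exact ihl hl fun u hu => h' u (Or.inl hu)
    · rw [e2]
      exact ihr hr fun u hu => h' u (Or.inr (Or.inr hu))

/-- What the main loop achieves for one block, between the states `s` and `s'`. -/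
structure SolvePost (A : Fin n → Fin n → Bool) (xs : List (Fin n)) (next slot : ℕ)
    (s s' : State) : Prop where
  top : s'.reg 3 = next
  good : Good A s'
  le_free : s.reg 4 ≤ s'.reg 4
  free_le : s'.reg 4 ≤ s.reg 4 + 21 * xs.length ^ 2
  unchanged : ∀ a < s.reg 4, a ≠ slot →
    (∀ v ∈ xs, a ≠ n * n + 2 * v.val ∧ a ≠ n * n + 2 * v.val + 1) → s'.mem a = s.mem a
  tree : ∃ T, IsGreedyTree A T xs ∧ Represents s'.mem (n * n) T (s'.mem slot)

/-- The rest of the stack is treated as a continuation: if the loop succeeds from every state in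
which this block is solved and popped, it succeeds now. Thus no invariant about the whole stack is
needed, and the induction follows the recursion tree. The budgets fit the factor 2/3 of
`pivot_balanced`: for memory, 14m² + (2m + 5) ≤ 21m². -/
theorem mainLoop_solve {W : ℕ} {A : Fin n → Fin n → Bool} (hA : IsTournamentRel A)
    (hnW : 8 * (n * n) + 8 < W) {Q : State → Prop} (xs : List (Fin n)) (hnd : xs.Nodup)
    (p next slot c : ℕ) (s : State) (hs : Good A s) (h3 : s.reg 3 = p)
    (hp : n * n + 2 * n < p) (hB : BlockAt s.mem p next slot xs)
    (hfree : p + 3 + xs.length ≤ s.reg 4) (hslot : n * n ≤ slot) (hslot' : slot ≤ n * n + 2 * n)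
    (hslot'' : ∀ v ∈ xs, slot ≠ n * n + 2 * v.val ∧ slot ≠ n * n + 2 * v.val + 1)
    (hW : s.reg 4 + 21 * xs.length ^ 2 + 2 * n + 6 < W) (hnext : next < p)
    (hQ : ∀ s', SolvePost A xs next slot s s' → WP W mainLoop c Q s') :
    WP W mainLoop (543 * xs.length ^ 2 + 21 + c) Q s := by
  obtain ⟨h0, h1, h2, h5, hin, hfr⟩ := id hs
  have hmn : xs.length ≤ n := by simpa using hnd.length_le_card
  by_cases hm : xs = []
  · subst hm
    simp only [List.length_nil] at *
    refine (wp_while_step (c := 11) (c' := c) (by omega) ?_).mono (by omega) fun _ h => h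
    refine wp_add (p + 1) (by rw [h3, h1]) (by omega) ?_
    refine wp_load (p + 1) slot (by simp) (by simp [hB.slot_eq]) (by omega) (by omega) ?_
    refine wp_add (p + 2) (by simp [h1]) (by omega) ?_
    refine wp_load (p + 2) 0 (by simp) (by simp [hB.length_eq]) (by omega) (by omega) ?_
    refine wp_add (p + 3) (by simp [h1]) (by omega) ?_
    refine wp_load p next (by simp [h3]) (by simp [hB.next_eq]) (by omega) (by omega) ?_
    refine wp_cons (c₂ := 1) (c₁ := 4) ((wp_ifLt (c := 2) (fun h => ?_) (fun _ => ?_)).mono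
      (by norm_num) fun _ h => h)
    · simp [h5] at h
    refine wp_store slot 0 (by simp) (by simp [h5]) (by omega) (by omega) ?_
    refine wp_nil (wp_nil (hQ _ ⟨by simp, ⟨by simp [h0], by simp [h1], by simp [h2], by simp [h5],
      hin.congr fun a ha => ?_, by simpa using hfr⟩, by simp, by simp, fun a _ ha _ => ?_, .nil,
      rfl, ?_⟩))
    · simp [show a ≠ slot by omega]
    · simp [ha]
    · simp [Represents]
  have hm1 : 1 ≤ xs.length := List.length_pos_iff.2 hm
  have hsq : xs.length ≤ xs.length ^ 2 := by nlinarith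
  -- One split costs at most 29 + 50 + 52 = 131 times m², since m ≥ 1; 139 leaves room for reading
  -- the block.
  refine (wp_while_step (c := 139 * xs.length ^ 2)
    (c' := 543 * xs.length ^ 2 + 20 + c - 139 * xs.length ^ 2) (by omega) ?_).mono (by omega)
    fun _ h => h
  have hcost : 139 * xs.length ^ 2 = (139 * xs.length ^ 2 - 7) + 1 + 6 := by omega
  rw [hcost]
  refine wp_add (p + 1) (by rw [h3, h1]) (by omega) ?_
  refine wp_load (p + 1) slot (by simp) (by simp [hB.slot_eq]) (by omega) (by omega) ?_
  refine wp_add (p + 2) (by simp [h1]) (by omega) ?_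
  refine wp_load (p + 2) xs.length (by simp) (by simp [hB.length_eq]) (by omega) (by omega) ?_
  refine wp_add (p + 3) (by simp [h1]) (by omega) ?_
  refine wp_load p next (by simp [h3]) (by simp [hB.next_eq]) (by omega) (by omega) ?_
  set s₁ := (((((((s.setReg 11 (p + 1)).setReg 6 slot).setReg 11 (p + 2)).setReg 7
    xs.length).setReg 8 (p + 3)).setReg 3 next)) with hs₁
  have hg₁ : Good A s₁ := ⟨by simp [hs₁, h0], by simp [hs₁, h1], by simp [hs₁, h2],
    by simp [hs₁, h5], by simpa [hs₁] using hin, by simpa [hs₁] using hfr⟩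
  have h4₁ : s₁.reg 4 = s.reg 4 := by simp [hs₁]
  refine wp_cons (c₂ := 1) ((wp_ifLt (c := 29 * xs.length ^ 2 + 50 * xs.length + 52) (fun _ =>
    (splitBlock_spec hA xs hnd hm (p + 3) next slot hg₁ (by simp [hs₁]) (by simp [hs₁])
    (by simp [hs₁]) (by simp [hs₁]) (by omega) (by omega) hslot (by omega) hnW
    (by omega) (by simpa [hs₁] using hB.stored))) (fun h => ?_)).mono (by omega) ?_)
  · exfalso
    simp [hs₁, h5] at h
    exact hm h
  rintro s₂ ⟨v, q₁, q₂, h⟩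
  refine wp_nil ?_
  obtain ⟨hab, hbal⟩ := pivot_balanced hA hnd h.mem_list h.min
  have hvn := v.isLt
  have hf₂ := h.free_le
  have hle₂ := h.le_free
  have hq₁ := h.le_q₁
  have hq₂ := h.le_q₂
  rw [h4₁] at hf₂ hq₁
  have hu₂ : ∀ a < s.reg 4, a ≠ slot → s₂.mem a = s.mem a := by
    intro a ha has
    rw [h.unchanged a (by omega) has]
    simp [hs₁]
  have hslotv := hslot'' v h.mem_list
  have htree := h.slot_eq
  have hL := h.left
  have hR := h.right
  have hvL : v ∉ xs.filter fun u => A u v := by simp [hA.1]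
  have hvR : v ∉ xs.filter (A v) := by simp [hA.1]
  have hdisj : ∀ u ∈ xs.filter (fun u => A u v), u ∉ xs.filter (A v) := by
    intro u hu hu'
    have e1 := (List.mem_filter.1 hu).2
    have e2 := (List.mem_filter.1 hu').2
    have huv : u ≠ v := fun e => hvL (e ▸ hu)
    simp [hA.2 u v huv, e2] at e1
  have hLx : ∀ u ∈ xs.filter (fun u => A u v), u ∈ xs := fun u hu => (List.mem_filter.1 hu).1
  have hRx : ∀ u ∈ xs.filter (A v), u ∈ xs := fun u hu => (List.mem_filter.1 hu).1
  have hLn : (xs.filter fun u => A u v).Nodup := hnd.filter _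
  have hRn : (xs.filter (A v)).Nodup := hnd.filter _
  have hmin := h.min
  have hvx := h.mem_list
  have hLlt : (xs.filter fun u => A u v).length < xs.length := by omega
  have hRlt : (xs.filter (A v)).length < xs.length := by omega
  have hne : ∀ u w : Fin n, u ≠ w → u.val ≠ w.val := fun u w h e => h (Fin.ext e)
  set L := xs.filter fun u => A u v with hLdef
  set R := xs.filter (A v) with hRdef
  have hLsq : L.length ^ 2 + R.length ^ 2 ≤ xs.length ^ 2 := by omega
  -- The left block is on top, so it is solved first, with the right block as its continuation. The
  -- two recursive budgets use at most 362m² + 42 of the remaining 404m² + 20.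
  refine (mainLoop_solve hA hnW L hLn q₂ q₁ (n * n + 2 * v.val)
    (543 * R.length ^ 2 + 21 + c) s₂ h.good h.top (by omega) hL (by omega) (by omega) (by omega)
    (fun u hu => ?_) (by omega) (by omega) (fun s₃ h₃ => ?_)).mono (by omega) fun _ h => h
  · have := hne u v fun e => hvL (e ▸ hu)
    omega
  have h₃f := h₃.le_free
  have h₃f' := h₃.free_le
  have hcell : ∀ a, n * n + 2 * n ≤ a → ∀ u ∈ xs, a ≠ n * n + 2 * u.val ∧
      a ≠ n * n + 2 * u.val + 1 := by
    intro a ha u _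
    have := u.isLt
    omega
  refine mainLoop_solve hA hnW R hRn q₁ next (n * n + 2 * v.val + 1)
    c s₃ h₃.good h₃.top (by omega) (hR.congr fun a ha ha' => ?_) (by omega) (by omega) (by omega)
    (fun u hu => ?_) (by omega) (by omega) (fun s₄ h₄ => ?_)
  · exact h₃.unchanged a (by omega) (by omega) fun u hu => hcell a (by omega) u (hLx u hu)
  · have := hne u v fun e => hvR (e ▸ hu)
    omega
  have h₄f := h₄.le_free
  have h₄f' := h₄.free_le
  obtain ⟨TL, hTL, hTLr⟩ := h₃.tree
  obtain ⟨TR, hTR, hTRr⟩ := h₄.tree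
  have hslotL : ∀ u ∈ L, slot ≠ n * n + 2 * u.val ∧ slot ≠ n * n + 2 * u.val + 1 :=
    fun u hu => hslot'' u (hLx u hu)
  have hslotR : ∀ u ∈ R, slot ≠ n * n + 2 * u.val ∧ slot ≠ n * n + 2 * u.val + 1 :=
    fun u hu => hslot'' u (hRx u hu)
  -- Solving the right block writes only its own slot, the slots of its own vertices and free
  -- memory, so the pointer to the left tree survives, as does the left tree below.
  have hkeepv : s₄.mem (n * n + 2 * v.val) = s₃.mem (n * n + 2 * v.val) := by
    refine h₄.unchanged _ (by omega) (by omega) fun u hu => ?_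
    have := hne u v fun e => hvR (e ▸ hu)
    omega
  refine hQ s₄ ⟨h₄.top, h₄.good, by omega, by omega, fun a ha has haxs => ?_, .node v TL TR,
    ⟨hvx, hmin, hTL, hTR⟩, ?_, ?_, hTRr⟩
  · have := haxs v hvx
    rw [h₄.unchanged a (by omega) (by omega) fun u hu => haxs u (hRx u hu),
      h₃.unchanged a (by omega) (by omega) fun u hu => haxs u (hLx u hu), hu₂ a ha has]
  · rw [h₄.unchanged slot (by omega) (by omega) hslotR,
      h₃.unchanged slot (by omega) (by omega) hslotL, htree]
  · rw [hkeepv]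
    refine hTLr.congr fun u hu => ?_
    have huL : u ∈ L := (inorder_perm_of_greedy hA hLn hTL).mem_iff.1 hu
    have hun := u.isLt
    have huv := hne u v fun e => hvL (e ▸ huL)
    constructor
    · refine h₄.unchanged _ (by omega) (by omega) fun w hw => ?_
      have := hne u w fun e => hdisj u huL (e ▸ hw)
      omega
    · refine h₄.unchanged _ (by omega) (by omega) fun w hw => ?_
      have := hne u w fun e => hdisj u huL (e ▸ hw)
      omega
termination_by xs.length
decreasing_by
  · exact hRlt
  · exact hLlt

end WordRAM

/-! ### Initialization and the complete program -/

namespace WordRAM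

variable {n : ℕ}

theorem hasInput_inputState (G : Digraph (Fin n)) (A : Fin n → Fin n → Bool)
    (hA : ∀ i j, A i j = true ↔ G.Adj i j) : HasInput A (inputState G).mem := by
  intro i j
  have key : (∃ i' j' : Fin n, i.val * n + j.val = i'.val * n + j'.val ∧ G.Adj i' j') ↔
      G.Adj i j := by
    constructor
    · rintro ⟨i', j', h, hadj⟩
      have hj : j = j' := by
        have := congrArg (· % n) h
        simp only [Nat.mul_add_mod', Nat.mod_eq_of_lt j.isLt, Nat.mod_eq_of_lt j'.isLt] at this
        exact Fin.ext this
      subst hj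
      have hi : i = i' := by
        have h' : i.val * n = i'.val * n := by omega
        exact Fin.ext (Nat.eq_of_mul_eq_mul_right (by have := j.isLt; omega) h')
      subst hi
      exact hadj
    · exact fun h => ⟨i, j, rfl, h⟩
  simp only [inputState]
  by_cases h : G.Adj i j
  · rw [if_pos (key.2 h), if_pos ((hA i j).2 h)]
  · rw [if_neg (mt key.1 h), if_neg (mt (hA i j).1 h)]

theorem inputState_mem_eq_zero (G : Digraph (Fin n)) {a : ℕ} (ha : n * n ≤ a) :
    (inputState G).mem a = 0 := by
  simp only [inputState, ite_eq_right_iff]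
  rintro ⟨i, j, rfl, -⟩
  exact absurd (cell_lt i j) (by omega)

/-- Find the tree whose root in each subtree is a vertex of the smallest score. -/
def shortcutTreeProgram : Program := block [
  .const 1 1, .mul 2 0 0, .add 26 2 0, .add 26 26 0, .add 3 26 1, .const 11 3, .add 8 3 11,
  .const 9 0, .whileLt 9 0 (block [.add 11 8 9, .store 11 9, .add 9 9 1]), .add 11 3 1,
  .store 11 26, .add 11 11 1, .store 11 0, .add 4 8 0, mainLoop, .load 0 26]

theorem shortcutTreeProgram_spec {W : ℕ} (hn : 1 ≤ n) (hW : 40 * (n * n) + 40 < W)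
    (G : Digraph (Fin n)) {A : Fin n → Fin n → Bool} (hA : IsTournamentRel A)
    (hAG : ∀ i j, A i j = true ↔ G.Adj i j) :
    WP W shortcutTreeProgram (1000 * n ^ 2) (fun s => ∃ T : BinaryTree (Fin n),
      Outputs s T ∧ IsGreedyTree A T (List.finRange n)) (inputState G) := by
  set s₀ := inputState G with hs₀
  have hnn : n ≤ n * n := Nat.le_mul_self n
  have h0 : s₀.reg 0 = n := by simp [hs₀, inputState]
  have hz : ∀ x, x ≠ 0 → s₀.reg x = 0 := by
    intro x hx
    simp [hs₀, inputState, hx]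
  have hin := hasInput_inputState G A hAG
  have hcost : 543 * n ^ 2 + 4 * n + 40 ≤ 1000 * n ^ 2 := by nlinarith
  refine WP.mono (c := (n * (3 + 1 + 1) + 1) + ((543 * n ^ 2 + 21 + 1 + 2) + 5) + 8) ?_
    (by nlinarith) fun _ h => h
  -- Behind the input and the 2n child cells lie the root's slot and the three header cells of the
  -- first block; its list starts here.
  set st := n * n + 2 * n + 4 with hst
  refine wp_const (by omega) (wp_mul (n * n) (by simp [h0]) (by omega)
    (wp_add (n * n + n) (by simp [h0]) (by omega)
    (wp_add (n * n + 2 * n) (by simp [h0]; ring) (by omega)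
    (wp_add (n * n + 2 * n + 1) (by simp) (by omega) (wp_const (by omega)
    (wp_add st (by simp [hst]) (by omega) (wp_const (by omega) ?_)))))))
  refine wp_cons' (wp_for (m := n) (c := 4)
    (fun i s => (∀ j < i, s.mem (st + j) = j) ∧ ∀ a < st, s.mem a = s₀.mem a)
    (by simp) (by simp [h0]) rfl (by simp) ?_) ?_
  · rintro i hi s h9 f ⟨hm, hm'⟩
    have f1 := f 1 rfl
    have f8 := f 8 rfl
    simp at f1 f8
    refine wp_add (st + i) (by rw [f8, h9]) (by omega) ?_
    refine wp_store (st + i) i (by simp) (by simp [h9]) (by omega) (by omega) ?_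
    refine wp_add (i + 1) (by simp [h9, f1]) (by omega) (wp_nil ⟨by simp, fun j hj => ?_,
      fun a ha => ?_⟩)
    · by_cases hji : j = i
      · simp [hji]
      · simp [hji, hm j (by omega)]
    · simp [show a ≠ st + i by omega, hm' a ha]
  rintro s f ⟨hm, hm'⟩
  have f0 := f 0 rfl
  have f1 := f 1 rfl
  have f2 := f 2 rfl
  have f3 := f 3 rfl
  have f5 := f 5 rfl
  have f8 := f 8 rfl
  have f26 := f 26 rfl
  simp [h0, hz 5] at f0 f1 f2 f3 f5 f8 f26
  refine wp_add (n * n + 2 * n + 2) (by simp [f3, f1]) (by omega) ?_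
  refine wp_store (n * n + 2 * n + 2) (n * n + 2 * n) (by simp) (by simp [f26]) (by omega)
    (by omega) ?_
  refine wp_add (n * n + 2 * n + 3) (by simp [f1]) (by omega) ?_
  refine wp_store (n * n + 2 * n + 3) n (by simp) (by simp [f0]) (by omega) (by omega) ?_
  refine wp_add (st + n) (by simp [f8, f0]) (by omega) ?_
  set s₁ := ((((s.setReg 11 (n * n + 2 * n + 2)).setMem (n * n + 2 * n + 2)
    (n * n + 2 * n)).setReg 11 (n * n + 2 * n + 3)).setMem (n * n + 2 * n + 3) n).setReg 4
    (st + n) with hs₁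
  have hgood : Good A s₁ := by
    refine ⟨by simp [hs₁, f0], by simp [hs₁, f1], by simp [hs₁, f2], by simp [hs₁, f5],
      hin.congr fun a ha => ?_, by simp [hs₁]; omega⟩
    simp [hs₁, show a ≠ n * n + 2 * n + 2 by omega, show a ≠ n * n + 2 * n + 3 by omega]
    exact hm' a (by omega)
  have h4 : s₁.reg 4 = st + n := by simp [hs₁]
  have hsq : n ^ 2 = n * n := sq n
  have hloop : WP W mainLoop (543 * n ^ 2 + 21 + 1)
      (SolvePost A (List.finRange n) 0 (n * n + 2 * n) s₁) s₁ := by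
    -- The cell of the next pointer is still 0 from the initial state, so the stack is empty after
    -- the first block and the continuation is one failed loop test.
    have h := mainLoop_solve (W := W) (Q := SolvePost A (List.finRange n) 0 (n * n + 2 * n) s₁) hA
      (by omega) (List.finRange n) (List.nodup_finRange n) (n * n + 2 * n + 1) 0 (n * n + 2 * n) 1
      s₁ hgood (by simp [hs₁, f3]) (by omega) ⟨?_, by simp [hs₁], by simp [hs₁], ?_⟩
      (by rw [List.length_finRange]; omega) (by omega) le_rfl
      (fun v _ => by have := v.isLt; omega) (by rw [List.length_finRange]; omega) (by omega)
      (fun s' h => wp_while_done (by rw [h.top]; omega) h)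
    · rwa [List.length_finRange] at h
    · simp [hs₁]
      rw [hm' _ (by omega), hs₀, inputState_mem_eq_zero G (by omega)]
    · intro j hj
      have e : n * n + 2 * n + 1 + 3 + j = st + j := by omega
      rw [e]
      simp [hs₁, show st + j ≠ n * n + 2 * n + 2 by omega,
        show st + j ≠ n * n + 2 * n + 3 by omega]
      exact hm j (by simpa using hj)
  refine wp_cons' (c₁ := 543 * n ^ 2 + 21 + 1) (c₂ := 2) hloop ?_
  rintro s₂ g h
  have g26 := g 26 rfl
  simp [hs₁, f26] at g26
  obtain ⟨T, hT, hTr⟩ := h.tree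
  have hsmall : s₂.mem (n * n + 2 * n) < W := by
    cases T with
    | nil =>
      rw [show s₂.mem (n * n + 2 * n) = 0 from hTr]
      omega
    | node v l r =>
      rw [hTr.1]
      have := v.isLt
      omega
  exact wp_load (n * n + 2 * n) _ g26 rfl (by omega) hsmall (wp_nil ⟨T, by
    simpa [Outputs] using hTr, hT⟩)

end WordRAM

/-! ### Assembly of the bounds -/

section Main

open Classical in
theorem Digraph.IsTournament.isTournamentRel {V : Type*} {G : Digraph V} (hG : G.IsTournament) :
    IsTournamentRel fun i j => decide (G.Adj i j) := by
  refine ⟨fun x => by simp [hG.1 x], fun x y hxy => ?_⟩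
  rcases hG.2 x y hxy with ⟨h, h'⟩ | ⟨h, h'⟩ <;> simp [h, h']

open Classical in
theorem exists_tree_of_program {n : ℕ} (hn : 1 ≤ n) {G : Digraph (Fin n)}
    (hG : G.IsTournament) :
    ∃ (steps : ℕ) (s : WordRAM.State) (T : BinaryTree (Fin n)),
      WordRAM.Exec ((n + 1) ^ 8) WordRAM.shortcutTreeProgram (WordRAM.inputState G) steps s ∧
      steps ≤ 1000 * n ^ 2 ∧
      WordRAM.Outputs s T ∧
      G.IsSpanningShortcutTree T ∧
      (n.choose 2 : ℝ) / 2 + (n * Real.log n) / 5 - 3122 ≤ (G.numShortcuts T : ℝ) := by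
  have hA := hG.isTournamentRel
  have hAG : ∀ i j, (fun i j => decide (G.Adj i j)) i j = true ↔ G.Adj i j := by simp
  -- As n ≥ 1, six of the eight factors already give 2⁶ = 64, and 64(n+1)² exceeds the memory bound.
  have hW : 40 * (n * n) + 40 < (n + 1) ^ 8 := by
    have h1 : 2 ^ 6 ≤ (n + 1) ^ 6 := Nat.pow_le_pow_left (by omega) 6
    have h2 : (n + 1) ^ 8 = (n + 1) ^ 6 * (n + 1) ^ 2 := by ring
    have h3 := Nat.mul_le_mul_right ((n + 1) ^ 2) h1
    nlinarith
  obtain ⟨steps, s, hsteps, hexec, T, hout, hT⟩ :=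
    WordRAM.shortcutTreeProgram_spec hn hW G hA hAG
  have hnd := List.nodup_finRange n
  have hperm := inorder_perm_of_greedy hA hnd hT
  have hspan : G.IsSpanningShortcutTree T :=
    ⟨hperm.nodup_iff.2 hnd, fun v => hperm.mem_iff.2 (List.mem_finRange v),
      isShortcutTree_of_greedy hAG hA hnd hT⟩
  refine ⟨steps, s, T, hexec, hsteps, hout, hspan, shortcut_bound_numeric n hn _ ?_⟩
  have hfwd := fwdCount_greedy_ge hA hnd hT
  rw [← numShortcuts_add hspan, List.length_finRange] at hfwd
  push_cast [Nat.cast_sub hn] at hfwd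
  exact hfwd

theorem exists_isTournament (n : ℕ) : ∃ G : Digraph (Fin n), G.IsTournament := by
  refine ⟨⟨fun i j => i < j⟩, fun v => lt_irrefl v, fun u v huv => ?_⟩
  rcases lt_or_gt_of_ne huv with h | h
  · exact Or.inl ⟨h, h.not_gt⟩
  · exact Or.inr ⟨h, h.not_gt⟩

theorem numPathShortcuts_le {V : Type*} (G : Digraph V) (p : List V) :
    G.numPathShortcuts p ≤ p.length * p.length := by
  classical
  rw [Digraph.numPathShortcuts]
  exact (Finset.card_filter_le _ _).trans (by simp)

theorem isGreatest_shortcutNumber {n : ℕ} (hn : 1 ≤ n) :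
    IsGreatest (guaranteedShortcuts n) (shortcutNumber n) := by
  have hbdd : BddAbove (guaranteedShortcuts n) := by
    obtain ⟨G, hG⟩ := exists_isTournament n
    refine ⟨n * n, fun k hk => ?_⟩
    obtain ⟨T, hT, hkT⟩ := hk G hG
    refine hkT.trans ((numPathShortcuts_le G _).trans ?_)
    rw [length_inorder_of_spanning hT]
  refine ⟨Nat.sSup_mem ⟨0, fun G hG => ?_⟩ hbdd, fun k hk => le_csSup hbdd hk⟩
  obtain ⟨-, -, T, -, -, -, hT, -⟩ := exists_tree_of_program hn hG
  exact ⟨T, hT, Nat.zero_le _⟩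

end Main

theorem theorem3 :
    -- `t(n)` is well defined: the maximum in its definition is attained
    (∀ n : ℕ, 1 ≤ n → IsGreatest (guaranteedShortcuts n) (shortcutNumber n)) ∧
    -- the lower bound
    (∀ n : ℕ, 1 ≤ n →
      (n.choose 2 : ℝ) / 2 + (n * Real.log n) / 5 - 3122 ≤ (shortcutNumber n : ℝ)) ∧
    -- the algorithm: one program, words of `O(log n)` bits, at most `C * n ^ 2` steps
    (∃ (P : WordRAM.Program) (c C : ℕ), ∀ n : ℕ, 1 ≤ n →
      ∀ G : Digraph (Fin n), G.IsTournament →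
        ∃ (steps : ℕ) (s : WordRAM.State) (T : BinaryTree (Fin n)),
          WordRAM.Exec ((n + 1) ^ c) P (WordRAM.inputState G) steps s ∧
          steps ≤ C * n ^ 2 ∧
          WordRAM.Outputs s T ∧
          G.IsSpanningShortcutTree T ∧
          (n.choose 2 : ℝ) / 2 + (n * Real.log n) / 5 - 3122 ≤ (G.numShortcuts T : ℝ)) ∧
    -- the upper bound, and a tournament that witnesses it
    (∀ᶠ n : ℕ in Filter.atTop,
      (shortcutNumber n : ℝ) ≤ (n.choose 2 : ℝ) / 2 + 4 * n * (Real.logb 2 n) ^ 2 ∧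
      ∃ G : Digraph (Fin n), G.IsTournament ∧
        ∀ T : BinaryTree (Fin n), G.IsSpanningShortcutTree T →
          (G.numShortcuts T : ℝ) ≤ (n.choose 2 : ℝ) / 2 + 4 * n * (Real.logb 2 n) ^ 2) := by
  refine ⟨fun n hn => isGreatest_shortcutNumber hn, fun n hn => ?_,
    ⟨WordRAM.shortcutTreeProgram, 8, 1000, fun n hn G hG => exists_tree_of_program hn hG⟩, ?_⟩
  -- The real bound need not be an integer, but its ceiling is a guaranteed number because shortcut
  -- counts are integers.
  · refine le_trans (Nat.le_ceil _) (Nat.cast_le.2 ((isGreatest_shortcutNumber hn).2 fun G hG => ?_))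
    obtain ⟨-, -, T, -, -, -, hT, hle⟩ := exists_tree_of_program hn hG
    exact ⟨T, hT, Nat.ceil_le.2 hle⟩
  · filter_upwards [eventually_exists_few_shortcuts, Filter.eventually_ge_atTop 1] with n h hn
    refine ⟨?_, h⟩
    obtain ⟨G, hG, hle⟩ := h
    obtain ⟨T, hT, hk⟩ := (isGreatest_shortcutNumber hn).1 G hG
    exact (Nat.cast_le.2 hk).trans (hle T hT)
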